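/- **Theorem 1.2.** There is an absolute constant $C$ such that for all integers $\Delta\ge 5$ and $n\ge 1$ and every real $0<\epsilon<1$ there are a non-negative integer $$K\ \le\ e^{C\Delta}\,\ln(n/\epsilon)$$ and a polynomial $Q=Q_{\Delta,n,\epsilon}$ in $K$ variables, with rational coefficients and $\deg Q\le K$, for which the following holds. Let $\Omega_1,\dots,\Omega_m$ be probability spaces, let $\Omega=\Omega_1\times\cdots\times\Omega_m$ be their product with the product measure $\mathbf P$, and let $A_1,\dots,A_n\subset\Omega$ be events. The set of coordinates that an event $A$ depends on is the smallest set $J\subset\{1,\dots,m\}$ such that membership of a point $x\in\Omega$ in $A$ is determined by the coordinates of $x$ with indices in $J$; two events share a coordinate if these sets intersect. Let $r_i,\Delta_i\ge 0$ be integers such that, for $i=1,\dots,n$, the event $A_i$ depends on at most $r_i$ coordinates and at most $\Delta_i$ of the events $A_j$ with $j\ne i$ share a coordinate with $A_i$. Suppose that $$\Delta=\max\{5,\ \Delta_1,\dots,\Delta_n\},\qquad \mu_i=\min\{r_i,\ \Delta_i+1\},\qquad \mathbf P(A_i)<(3\Delta)^{-3\mu_i}\quad\text{for } i=1,\dots,n,$$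 and put $$p=\mathbf P\Bigl(\bigcap_{i=1}^n\overline{A_i}\Bigr),\qquad \sigma_k=\sum_{1\le i_1<\cdots<i_k\le n}\mathbf P\bigl(A_{i_1}\cap\cdots\cap A_{i_k}\bigr)\quad (1\le k\le K),$$ where $\overline{A_i}$ is the complement of $A_i$ and $\sigma_k=0$ if $k>n$. Then $p>0$, $$\bigl|\ln p-Q(\sigma_1,\dots,\sigma_K)\bigr|\le\epsilon ,$$ and $p$ is determined by $\sigma_1,\dots,\sigma_K$ up to relative error $\epsilon$, namely $$\bigl|e^{Q(\sigma_1,\dots,\sigma_K)}-p\bigr|\le\epsilon\,p .$$ -/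

import Mathlib

open MeasureTheory

universe u

/-- The set `J_f` of coordinates that a function `f` on a product depends on: the intersection of
all sets `J` of coordinates such that `f x = f y` whenever `x` and `y` agree on `J`
(Mathlib's `DependsOn f J`). For finitely many coordinates it is the unique minimal such `J`, see
`minimal_dependsOn_iff`. -/
def coordSet {ι : Type*} {Ω : ι → Type*} {β : Type*} (f : (∀ j, Ω j) → β) : Set ι :=
  ⋂₀ {J : Set ι | DependsOn f J}

theorem dependsOn_inter {ι : Type*} {Ω : ι → Type*} {β : Type*} {f : (∀ j, Ω j) → β}
    {J J' : Set ι} (h : DependsOn f J) (h' : DependsOn f J') : DependsOn f (J ∩ J') := by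
  classical
  intro x y hxy
  have h1 : f x = f (fun j => if j ∈ J then x j else y j) :=
    h (fun j hj => by simp [hj])
  have h2 : f (fun j => if j ∈ J then x j else y j) = f y := by
    refine h' (fun j hj => ?_)
    by_cases hJ : j ∈ J
    · simpa [hJ] using hxy j ⟨hJ, hj⟩
    · simp [hJ]
  exact h1.trans h2

theorem dependsOn_coordSet {ι : Type*} [Finite ι] {Ω : ι → Type*} {β : Type*}
    (f : (∀ j, Ω j) → β) : DependsOn f (coordSet f) := by
  have key : ∀ s : Set (Set ι), s.Finite → (∀ J ∈ s, DependsOn f J) → DependsOn f (⋂₀ s) := by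
    intro s hs
    induction s, hs using Set.Finite.induction_on with
    | empty => intro _; simpa using dependsOn_univ f
    | insert _ _ ih =>
      intro h
      rw [Set.sInter_insert]
      exact dependsOn_inter (h _ (Set.mem_insert _ _))
        (ih fun J hJ => h J (Set.mem_insert_of_mem _ hJ))
  exact key _ (Set.toFinite _) fun _ hJ => hJ

/-- `coordSet f` is the one and only minimal set of coordinates that determines `f`. -/
theorem minimal_dependsOn_iff {ι : Type*} [Finite ι] {Ω : ι → Type*} {β : Type*}
    (f : (∀ j, Ω j) → β) (J : Set ι) : Minimal (DependsOn f) J ↔ J = coordSet f := by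
  have hle : ∀ J' : Set ι, DependsOn f J' → coordSet f ≤ J' := fun J' h => Set.sInter_subset_of_mem h
  constructor
  · intro h
    exact le_antisymm (h.2 (dependsOn_coordSet f) (hle J h.1)) (hle J h.1)
  · rintro rfl
    exact ⟨dependsOn_coordSet f, fun J' h _ => hle J' h⟩

/-- The set of coordinates that an event `A` depends on, i.e. that its indicator depends on. -/
noncomputable def eventCoords {m : ℕ} {Ω : Fin m → Type*} (A : Set (∀ j, Ω j)) : Set (Fin m) :=
  coordSet (A.indicator (fun _ => (1 : ℂ)))

/-- Two events share a coordinate. -/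
def ShareCoordinate {m : ℕ} {Ω : Fin m → Type*} (A B : Set (∀ j, Ω j)) : Prop :=
  (eventCoords A ∩ eventCoords B).Nonempty

/-- `σ_k`: the sum of the probabilities of the intersections `A_{i₁} ∩ ⋯ ∩ A_{i_k}` over all
`i₁ < ⋯ < i_k`, that is, over all `k`-element sets of indices. -/
noncomputable def intersectionSum {X : Type*} [MeasurableSpace X] (P : Measure X) {n : ℕ}
    (A : Fin n → Set X) (k : ℕ) : ℝ :=
  ∑ s ∈ (Finset.univ : Finset (Fin n)).powersetCard k, P.real (⋂ i ∈ s, A i)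

/-! Let `G(z) = E ∏ (1 - z 1_{A_k}) = ∑ σ_k (-z)^k`, so that `G(0) = 1` and `G(1) = p`. The main
point is that `G` has no zeros in the disc of radius `1 + 1/Δ` about `1`, which contains `0` in its
interior. The rest is interpolation. A Möbius map carries the closed unit disc onto that disc, with
`0 ↦ 0` and `b = Δ/(Δ+1) ↦ 1`. The pull-back of `G`, cleared of denominators, is a polynomial of
degree at most `n` without zeros in the unit disc, so the Taylor series of its logarithm converges
geometrically at `b`. Newton's identities express the first `K` Taylor coefficients through `σ_1, …,
σ_K` (`abs_log_sub_aeval_logTaylorPoly_le`).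

Zero-freeness is proved by revealing coordinates. For a set `S` of events that are unlikely given
the coordinates in `J`, one bounds how the conditional expectation of the product over `S` grows
when the coordinates of further events are revealed: by a factor `κ` for one event in the worst case
(`RevealBound`), and by `1 + η` per event for the mean modulus (`MeanRevealBound`). Both are proved
by one induction on `S` (`revealBound_and_meanRevealBound`). The worst-case bound shows that adding
an event changes the expectation by a relative amount at most `a < 1`, so it never vanishes.
Revealing an event `u` affects at most `d` events of `S`. Those that become likely are revealed too,
and their factors are bounded by `R`; this is costly but rare, since "unlikely" means `t ^ rank *
probability < 1` and the rank of each affected event drops. Averaging then gives the factor `1 + η`.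
-/

set_option linter.unusedSectionVars false

/-! ### Combining two points of a product space -/

section Mixing

variable {ι : Type*} {Ω : ι → Type*}

open Classical in
/-- The point with the coordinates of `x` on `J` and those of `y` off `J`. -/
noncomputable def mix (J : Set ι) (x y : ∀ j, Ω j) : ∀ j, Ω j := fun j => if j ∈ J then x j else y j

theorem mix_of_mem {J : Set ι} {j : ι} (h : j ∈ J) (x y : ∀ j, Ω j) : mix J x y j = x j := by
  simp [mix, h]

theorem mix_empty (x y : ∀ j, Ω j) : mix ∅ x y = y := by
  funext j; simp [mix]

theorem mix_mix {J J' : Set ι} (h : J ⊆ J') (x y y' : ∀ j, Ω j) :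
    mix J' (mix J x y) y' = mix J x (mix J' y y') := by
  funext j
  by_cases hJ : j ∈ J
  · simp [mix, hJ, h hJ]
  · simp [mix, hJ]

variable [∀ j, MeasurableSpace (Ω j)]

theorem measurable_mix (J : Set ι) :
    Measurable fun p : (∀ j, Ω j) × (∀ j, Ω j) => mix J p.1 p.2 := by
  refine measurable_pi_iff.2 fun j => ?_
  by_cases h : j ∈ J
  · simp only [mix, h, if_true]; fun_prop
  · simp only [mix, h, if_false]; fun_prop

theorem measurable_mix_left (J : Set ι) (x : ∀ j, Ω j) : Measurable fun y => mix J x y :=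
  (measurable_mix J).comp measurable_prodMk_left

variable [Fintype ι] (P : ∀ j, Measure (Ω j)) [∀ j, IsProbabilityMeasure (P j)]

/-- The coordinates are independent, so replacing some of them by those of an independent copy
preserves the law. The tower property rests on this. -/
theorem map_mix_prod (J : Set ι) :
    Measure.map (fun p : (∀ j, Ω j) × (∀ j, Ω j) => mix J p.1 p.2)
      ((Measure.pi P).prod (Measure.pi P)) = Measure.pi P := by
  classical
  symm
  refine Measure.pi_eq fun s hs => ?_
  rw [Measure.map_apply (measurable_mix J) (MeasurableSet.univ_pi hs)]
  have : (fun p : (∀ j, Ω j) × (∀ j, Ω j) => mix J p.1 p.2) ⁻¹' (Set.univ.pi s) =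
      (Set.univ.pi fun j => if j ∈ J then s j else Set.univ) ×ˢ
      (Set.univ.pi fun j => if j ∈ J then Set.univ else s j) := by
    ext p
    simp only [Set.mem_preimage, Set.mem_pi, Set.mem_univ, true_imp_iff, Set.mem_prod, mix]
    rw [← forall_and]
    refine forall_congr' fun j => ?_
    by_cases h : j ∈ J <;> simp [h]
  rw [this, Measure.prod_prod, Measure.pi_pi, Measure.pi_pi, ← Finset.prod_mul_distrib]
  refine Finset.prod_congr rfl fun j _ => ?_
  by_cases h : j ∈ J <;> simp [h]

end Mixing

/-! ### Bounded measurable functions -/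

section BddMeas

variable {X : Type*} [MeasurableSpace X] {E : Type*} [NormedAddCommGroup E]

/-- Bounded strongly measurable functions. -/
structure BddMeas (g : X → E) : Prop where
  sm : StronglyMeasurable g
  bdd : ∃ C, ∀ x, ‖g x‖ ≤ C

theorem BddMeas.norm {g : X → E} (h : BddMeas g) : BddMeas fun x => ‖g x‖ :=
  ⟨h.sm.norm, by simpa using h.bdd⟩

theorem BddMeas.const (c : E) : BddMeas fun _ : X => c :=
  ⟨stronglyMeasurable_const, ‖c‖, fun _ => le_rfl⟩

theorem BddMeas.mul {𝕜 : Type*} [RCLike 𝕜] {f g : X → 𝕜} (hf : BddMeas f) (hg : BddMeas g) :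
    BddMeas fun x => f x * g x := by
  obtain ⟨a, ha⟩ := hf.bdd
  obtain ⟨b, hb⟩ := hg.bdd
  refine ⟨hf.sm.mul hg.sm, a * b, fun x => ?_⟩
  rw [norm_mul]
  exact mul_le_mul (ha x) (hb x) (norm_nonneg _) ((norm_nonneg _).trans (ha x))

theorem BddMeas.add {f g : X → E} (hf : BddMeas f) (hg : BddMeas g) :
    BddMeas fun x => f x + g x := by
  obtain ⟨a, ha⟩ := hf.bdd
  obtain ⟨b, hb⟩ := hg.bdd
  exact ⟨hf.sm.add hg.sm, a + b, fun x => (norm_add_le _ _).trans (add_le_add (ha x) (hb x))⟩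

theorem BddMeas.sub {f g : X → E} (hf : BddMeas f) (hg : BddMeas g) :
    BddMeas fun x => f x - g x := by
  obtain ⟨a, ha⟩ := hf.bdd
  obtain ⟨b, hb⟩ := hg.bdd
  exact ⟨hf.sm.sub hg.sm, a + b, fun x => (norm_sub_le _ _).trans (add_le_add (ha x) (hb x))⟩

theorem BddMeas.prod {𝕜 : Type*} [RCLike 𝕜] {I : Type*} {f : I → X → 𝕜} (S : Finset I)
    (h : ∀ i ∈ S, BddMeas (f i)) : BddMeas fun x => ∏ i ∈ S, f i x := by
  classical
  induction S using Finset.induction_on with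
  | empty => simpa using BddMeas.const (X := X) (1 : 𝕜)
  | insert i S hi ih =>
    simp only [Finset.prod_insert hi]
    exact (h i (by simp)).mul (ih fun j hj => h j (by simp [hj]))

theorem BddMeas.sum {I : Type*} {f : I → X → E} (S : Finset I)
    (h : ∀ i ∈ S, BddMeas (f i)) : BddMeas fun x => ∑ i ∈ S, f i x := by
  classical
  induction S using Finset.induction_on with
  | empty => simpa using BddMeas.const (X := X) (0 : E)
  | insert i S hi ih =>
    simp only [Finset.sum_insert hi]
    exact (h i (by simp)).add (ih fun j hj => h j (by simp [hj]))

theorem BddMeas.indicator_one {𝕜 : Type*} [RCLike 𝕜] {A : Set X} (hA : MeasurableSet A) :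
    BddMeas (A.indicator fun _ => (1 : 𝕜)) := by
  refine ⟨stronglyMeasurable_const.indicator hA, 1, fun x => ?_⟩
  by_cases h : x ∈ A <;> simp [h]

theorem BddMeas.comp {Y : Type*} [MeasurableSpace Y] {g : X → E} (h : BddMeas g) {φ : Y → X}
    (hφ : Measurable φ) : BddMeas fun y => g (φ y) :=
  ⟨h.sm.comp_measurable hφ, h.bdd.imp fun _ hC _ => hC _⟩

theorem BddMeas.integrable {g : X → E} (h : BddMeas g) (μ : Measure X) [IsFiniteMeasure μ] :
    Integrable g μ := by
  obtain ⟨C, hC⟩ := h.bdd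
  exact Integrable.of_bound h.sm.aestronglyMeasurable C (Filter.Eventually.of_forall hC)

end BddMeas

/-! ### Conditional expectation given a set of coordinates -/

section CondE

variable {ι : Type*} [Fintype ι] {Ω : ι → Type*} [∀ j, MeasurableSpace (Ω j)]
  (P : ∀ j, Measure (Ω j)) [∀ j, IsProbabilityMeasure (P j)]
  {E : Type*} [NormedAddCommGroup E] [NormedSpace ℝ E] [CompleteSpace E]

/-- The conditional expectation of `g` given the coordinates in `J`, as a function on the whole
product. -/
noncomputable def condE (J : Set ι) (g : (∀ j, Ω j) → E) (x : ∀ j, Ω j) : E :=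
  ∫ y, g (mix J x y) ∂(Measure.pi P)

theorem BddMeas.mix {g : (∀ j, Ω j) → E} (h : BddMeas g) (J : Set ι) (x : ∀ j, Ω j) :
    BddMeas fun y => g (mix J x y) :=
  h.comp (measurable_mix_left J x)

theorem BddMeas.integrable_mix {g : (∀ j, Ω j) → E} (h : BddMeas g) (J : Set ι) (x : ∀ j, Ω j) :
    Integrable (fun y => g (_root_.mix J x y)) (Measure.pi P) :=
  (h.mix J x).integrable _

theorem BddMeas.condE {g : (∀ j, Ω j) → E} (h : BddMeas g) (J : Set ι) :
    BddMeas (condE P J g) := by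
  refine ⟨?_, ?_⟩
  · exact StronglyMeasurable.integral_prod_right' (ν := Measure.pi P)
      (f := fun p : (∀ j, Ω j) × (∀ j, Ω j) => g (_root_.mix J p.1 p.2))
      (h.sm.comp_measurable (measurable_mix J))
  · obtain ⟨C, hC⟩ := h.bdd
    refine ⟨C, fun x => ?_⟩
    have := norm_integral_le_of_norm_le_const (μ := Measure.pi P)
      (f := fun y => g (_root_.mix J x y)) (C := C) (Filter.Eventually.of_forall fun y => hC _)
    simpa [_root_.condE] using this

theorem condE_empty (g : (∀ j, Ω j) → E) (x : ∀ j, Ω j) :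
    condE P ∅ g x = ∫ y, g y ∂(Measure.pi P) := by
  simp [condE, mix_empty]

/-- Tower property, valid at every point and not just almost everywhere: by `mix_mix` the two
resamplings merge into one, whose law is given by `map_mix_prod`. -/
theorem condE_condE {g : (∀ j, Ω j) → E} (h : BddMeas g) {J J' : Set ι} (hJ : J ⊆ J')
    (x : ∀ j, Ω j) : condE P J (condE P J' g) x = condE P J g x := by
  have hm : AEStronglyMeasurable (fun y => g (mix J x y)) (Measure.map
      (fun p : (∀ j, Ω j) × (∀ j, Ω j) => mix J' p.1 p.2)
      ((Measure.pi P).prod (Measure.pi P))) := (h.mix J x).sm.aestronglyMeasurable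
  have h1 : condE P J g x = ∫ p : (∀ j, Ω j) × (∀ j, Ω j), g (mix J x (mix J' p.1 p.2))
      ∂((Measure.pi P).prod (Measure.pi P)) := by
    rw [← integral_map (measurable_mix J').aemeasurable hm, map_mix_prod, condE]
  rw [h1, integral_prod]
  · simp only [condE, mix_mix hJ]
  · exact ((h.mix J x).comp (measurable_mix J')).integrable _

theorem norm_condE_le (J : Set ι) (g : (∀ j, Ω j) → E) (x : ∀ j, Ω j) :
    ‖condE P J g x‖ ≤ condE P J (fun y => ‖g y‖) x :=
  norm_integral_le_integral_norm _

theorem condE_mono {f g : (∀ j, Ω j) → ℝ} (hf : BddMeas f) (hg : BddMeas g) (J : Set ι)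
    (x : ∀ j, Ω j) (h : ∀ y, f (mix J x y) ≤ g (mix J x y)) :
    condE P J f x ≤ condE P J g x :=
  integral_mono (hf.integrable_mix P J x) (hg.integrable_mix P J x) h

theorem condE_const_mul {𝕜 : Type*} [RCLike 𝕜] (c : 𝕜) (g : (∀ j, Ω j) → 𝕜) (J : Set ι)
    (x : ∀ j, Ω j) : condE P J (fun y => c * g y) x = c * condE P J g x :=
  integral_const_mul _ _

theorem condE_const (c : E) (J : Set ι) (x : ∀ j, Ω j) : condE P J (fun _ => c) x = c := by
  simp [condE, integral_const]

theorem condE_congr {f g : (∀ j, Ω j) → E} (J : Set ι) (x : ∀ j, Ω j)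
    (h : ∀ y, f (mix J x y) = g (mix J x y)) : condE P J f x = condE P J g x := by
  simp [condE, h]

theorem condE_mul_left {𝕜 : Type*} [RCLike 𝕜] {f : (∀ j, Ω j) → 𝕜} {J : Set ι}
    (hf : DependsOn f J) (g : (∀ j, Ω j) → 𝕜) (x : ∀ j, Ω j) :
    condE P J (fun y => f y * g y) x = f x * condE P J g x := by
  rw [← condE_const_mul]
  refine condE_congr P J x fun y => ?_
  rw [hf fun j hj => mix_of_mem hj x y]

theorem condE_of_dependsOn {f : (∀ j, Ω j) → E} {J : Set ι} (hf : DependsOn f J)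
    (x : ∀ j, Ω j) : condE P J f x = f x := by
  rw [← condE_const P (f x) J x]
  exact condE_congr P J x fun y => hf fun j hj => mix_of_mem hj x y

theorem dependsOn_condE (g : (∀ j, Ω j) → E) (J : Set ι) : DependsOn (condE P J g) J := by
  intro x y hxy
  have : ∀ z, mix J x z = mix J y z := fun z => by
    funext j
    by_cases h : j ∈ J
    · simp [mix, h, hxy j h]
    · simp [mix, h]
  simp [condE, this]

/-- Revealing coordinates that `g` does not see changes nothing. -/
theorem condE_union_mix {g : (∀ j, Ω j) → E} {V J W : Set ι} (hg : DependsOn g V)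
    (h : (W ∩ V) \ J = ∅) (x y : ∀ j, Ω j) :
    condE P (J ∪ W) g (mix J x y) = condE P J g x := by
  have : ∀ z, g (mix (J ∪ W) (mix J x y) z) = g (mix J x z) := fun z => by
    refine hg fun j hj => ?_
    by_cases hJ : j ∈ J
    · simp [mix, hJ]
    · have hW : j ∉ W := fun hW => by
        have : j ∈ (W ∩ V) \ J := ⟨⟨hW, hj⟩, hJ⟩
        simp [h] at this
      simp [mix, hJ, hW]
  simp [condE, this]

end CondE

/-! ### The rank of an event under revealing -/

section Degree

variable {ι I : Type*} [Finite ι] [Finite I] (W : I → Set ι)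

/-- The number of coordinates of the event `k` off `J`, or one more than the number of events that
share such a coordinate with it, whichever is smaller. -/
noncomputable def revealRank (J : Set ι) (k : I) : ℕ :=
  min (W k \ J).ncard ({j | j ≠ k ∧ ((W j ∩ W k) \ J).Nonempty}.ncard + 1)

theorem revealRank_anti {J J' : Set ι} (h : J ⊆ J') (k : I) :
    revealRank W J' k ≤ revealRank W J k := by
  refine min_le_min (Set.ncard_le_ncard (Set.sdiff_subset_sdiff_right h) (Set.toFinite _)) ?_
  refine Nat.add_le_add_right (Set.ncard_le_ncard ?_ (Set.toFinite _)) 1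
  exact fun j hj => ⟨hj.1, hj.2.mono (Set.sdiff_subset_sdiff_right h)⟩

/-- A newly revealed shared coordinate leaves `W k \ J`, and `u` leaves the set of neighbours of
`k`, so both entries of the minimum drop. -/
theorem revealRank_union_lt {J : Set ι} {u k : I} (huk : u ≠ k)
    (h : ((W u ∩ W k) \ J).Nonempty) :
    revealRank W (J ∪ W u) k + 1 ≤ revealRank W J k := by
  obtain ⟨l, ⟨hlu, hlk⟩, hlJ⟩ := h
  have h1 : (W k \ (J ∪ W u)).ncard < (W k \ J).ncard := by
    refine Set.ncard_lt_ncard ⟨Set.sdiff_subset_sdiff_right Set.subset_union_left, fun hs => ?_⟩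
      (Set.toFinite _)
    exact (hs ⟨hlk, hlJ⟩).2 (Or.inr hlu)
  have h2 : {j | j ≠ k ∧ ((W j ∩ W k) \ (J ∪ W u)).Nonempty}.ncard <
      {j | j ≠ k ∧ ((W j ∩ W k) \ J).Nonempty}.ncard := by
    refine Set.ncard_lt_ncard ⟨fun j hj => ⟨hj.1, hj.2.mono
      (Set.sdiff_subset_sdiff_right Set.subset_union_left)⟩, fun hs => ?_⟩ (Set.toFinite _)
    obtain ⟨-, j, ⟨hj, -⟩, hj'⟩ := @hs u ⟨huk, l, ⟨hlu, hlk⟩, hlJ⟩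
    exact hj' (Or.inr hj)
  simp only [revealRank]
  omega

end Degree

/-! ### Zero-freeness by revealing coordinates -/

section ZeroFree

variable {ι : Type*} [Fintype ι] {Ω : ι → Type*} [∀ j, MeasurableSpace (Ω j)]
  (P : ∀ j, Measure (Ω j)) [∀ j, IsProbabilityMeasure (P j)]
  {I : Type*} [Finite I] [DecidableEq I] (A : I → Set (∀ j, Ω j)) (W : I → Set ι)

/-- The product over `k ∈ S` of the functions that are `1 - z` on `A k` and `1` off `A k`. -/
noncomputable def avoidProd (z : ℂ) (S : Finset I) (x : ∀ j, Ω j) : ℂ :=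
  ∏ k ∈ S, (1 - z * (A k).indicator (fun _ => (1 : ℂ)) x)

/-- The conditional probability of the event `A k`, given the coordinates in `J`. -/
noncomputable def condProb (J : Set ι) (k : I) (x : ∀ j, Ω j) : ℝ :=
  condE P J ((A k).indicator fun _ => (1 : ℝ)) x

/-- Given the coordinates of `x` in `J`, every event of `S` is still unlikely. -/
def Unlikely (t : ℝ) (S : Finset I) (J : Set ι) (x : ∀ j, Ω j) : Prop :=
  ∀ k ∈ S, t ^ revealRank W J k * condProb P A J k x < 1

theorem Unlikely.subset {t : ℝ} {S S' : Finset I} {J : Set ι} {x : ∀ j, Ω j}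
    (h : Unlikely P A W t S J x) (hS : S' ⊆ S) : Unlikely P A W t S' J x :=
  fun k hk => h k (hS hk)

variable {A W} (hA : ∀ k, MeasurableSet (A k)) (hW : ∀ k, DependsOn (fun x => x ∈ A k) (W k))

include hA in
theorem bddMeas_avoidProd (z : ℂ) (S : Finset I) : BddMeas (avoidProd A z S) :=
  BddMeas.prod S fun k _ => (BddMeas.const 1).sub
    ((BddMeas.const z).mul (BddMeas.indicator_one (hA k)))

theorem dependsOn_indicator {𝕜 : Type*} [RCLike 𝕜] {B : Set (∀ j, Ω j)} {V : Set ι}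
    (h : DependsOn (fun x => x ∈ B) V) : DependsOn (B.indicator fun _ => (1 : 𝕜)) V := by
  intro x y hxy
  have : (x ∈ B) = (y ∈ B) := h hxy
  by_cases hx : x ∈ B
  · have hy : y ∈ B := this ▸ hx
    simp [hx, hy]
  · have hy : y ∉ B := this ▸ hx
    simp [hx, hy]

include hW in
theorem dependsOn_avoidProd (z : ℂ) (S : Finset I) {V : Set ι} (hV : ∀ k ∈ S, W k ⊆ V) :
    DependsOn (avoidProd A z S) V := by
  intro x y hxy
  refine Finset.prod_congr rfl fun k hk => ?_
  rw [dependsOn_indicator (𝕜 := ℂ) (hW k) fun j hj => hxy j (hV k hk hj)]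

theorem norm_avoidProd_le {z : ℂ} {R : ℝ} (hR : 1 ≤ R) (hz : ‖1 - z‖ ≤ R) (S : Finset I)
    (x : ∀ j, Ω j) : ‖avoidProd A z S x‖ ≤ R ^ S.card := by
  rw [avoidProd, norm_prod]
  refine (Finset.prod_le_prod (fun _ _ => norm_nonneg _) fun k _ => ?_).trans_eq
    (Finset.prod_const R)
  by_cases hx : x ∈ A k
  · simpa [hx] using hz
  · simpa [hx] using hR

theorem avoidProd_sdiff (z : ℂ) {S B : Finset I} (hB : B ⊆ S) (x : ∀ j, Ω j) :
    avoidProd A z S x = avoidProd A z B x * avoidProd A z (S \ B) x := by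
  rw [avoidProd, ← Finset.prod_sdiff hB, mul_comm]
  rfl

theorem condProb_nonneg (J : Set ι) (k : I) (x : ∀ j, Ω j) : 0 ≤ condProb P A J k x :=
  integral_nonneg fun _ => Set.indicator_nonneg (fun _ _ => zero_le_one) _

include hW in
-- Positive rank gives `1 / t` at once. Rank `0` means that all coordinates of the event are
-- revealed, so its conditional probability is `0` or `1`, and `1` is excluded.
theorem condProb_le_inv {t : ℝ} (ht : 1 ≤ t) {J : Set ι} {k : I} {x : ∀ j, Ω j}
    (h : t ^ revealRank W J k * condProb P A J k x < 1) : condProb P A J k x ≤ 1 / t := by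
  have ht0 : 0 < t := by linarith
  have hq := condProb_nonneg P (A := A) J k x
  rcases Nat.eq_zero_or_pos (revealRank W J k) with h0 | h0
  · have hJ : W k ⊆ J := by
      have : (W k \ J).ncard = 0 := by
        rcases Nat.min_eq_zero_iff.1 h0 with h | h
        · exact h
        · omega
      rw [Set.ncard_eq_zero (Set.toFinite _)] at this
      exact Set.sdiff_eq_empty.1 this
    have hd : DependsOn ((A k).indicator fun _ => (1 : ℝ)) J := fun x y hxy =>
      dependsOn_indicator (hW k) fun j hj => hxy j (hJ hj)
    rw [h0, pow_zero, one_mul, condProb, condE_of_dependsOn P hd] at h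
    rw [condProb, condE_of_dependsOn P hd]
    by_cases hx : x ∈ A k
    · simp [hx] at h
    · simp [hx, ht0.le]
  · rw [le_div_iff₀ ht0]
    have : t ^ 1 ≤ t ^ revealRank W J k := pow_le_pow_right₀ ht h0
    nlinarith

/-- Conditional Jensen: the modulus of a martingale is a submartingale. -/
theorem condE_norm_condE_mono {g : (∀ j, Ω j) → ℂ} (hg : BddMeas g) {J J' J'' : Set ι}
    (h : J ⊆ J') (h' : J' ⊆ J'') (x : ∀ j, Ω j) :
    condE P J (fun y => ‖condE P J' g y‖) x ≤ condE P J (fun y => ‖condE P J'' g y‖) x := by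
  rw [← condE_condE P (hg.condE P J'').norm h]
  refine condE_mono P (hg.condE P J').norm ((hg.condE P J'').norm.condE P J') J x fun y => ?_
  rw [← condE_condE P hg h']
  exact norm_condE_le P _ _ _

theorem condE_norm_condE_self (g : (∀ j, Ω j) → ℂ) (J : Set ι) (x : ∀ j, Ω j) :
    condE P J (fun y => ‖condE P J g y‖) x = ‖condE P J g x‖ :=
  condE_of_dependsOn P (f := fun y => ‖condE P J g y‖)
    (fun _ _ hxy => by simp only [dependsOn_condE P g J hxy]) x

variable (A W) in
/-- Revealing the coordinates of one more event multiplies the conditional expectation of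
`avoidProd A z S` by at most `κ`. -/
def RevealBound (z : ℂ) (t κ : ℝ) (S : Finset I) : Prop :=
  ∀ J x, Unlikely P A W t S J x → ∀ u ∉ S, ∀ y,
    ‖condE P (J ∪ W u) (avoidProd A z S) (mix J x y)‖ ≤ κ * ‖condE P J (avoidProd A z S) x‖

variable (A W) in
/-- Revealing the coordinates of the events in `U` increases the mean modulus of the conditional
expectation of `avoidProd A z S` by a factor of at most `(1 + η) ^ #U`. -/
def MeanRevealBound (z : ℂ) (t η : ℝ) (S : Finset I) : Prop :=
  ∀ J x, Unlikely P A W t S J x → ∀ U : Finset I, Disjoint U S →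
    condE P J (fun y => ‖condE P (J ∪ ⋃ u ∈ U, W u) (avoidProd A z S) y‖) x ≤
      (1 + η) ^ U.card * ‖condE P J (avoidProd A z S) x‖

include hA hW in
-- The difference is `-z` times the expectation of the product over `S` restricted to `A i`. Once
-- the coordinates of `i` are revealed, the indicator is known and `RevealBound` applies, leaving
-- `‖z‖ κ` times the probability of `A i`, which is at most `1 / t`.
theorem norm_condE_avoidProd_insert_sub_le {z : ℂ} {t κ a : ℝ} (ht : 1 ≤ t) (hκ : 0 ≤ κ)
    (ha : ‖z‖ * κ ≤ a * t) {S : Finset I} (hS : RevealBound P A W z t κ S) {i : I} (hi : i ∉ S)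
    {J : Set ι} {x : ∀ j, Ω j} (h : Unlikely P A W t (insert i S) J x) :
    ‖condE P J (avoidProd A z (insert i S)) x - condE P J (avoidProd A z S) x‖ ≤
      a * ‖condE P J (avoidProd A z S) x‖ := by
  set F := condE P J (avoidProd A z S) x with hF
  set χ : (∀ j, Ω j) → ℂ := (A i).indicator fun _ => (1 : ℂ) with hχ
  have ht0 : 0 < t := by linarith
  have hbS := bddMeas_avoidProd hA z S
  have hbχ : BddMeas χ := BddMeas.indicator_one (hA i)
  have hq : condProb P A J i x ≤ 1 / t := condProb_le_inv P hW ht (h i (by simp))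
  have e1 : condE P J (avoidProd A z (insert i S)) x - F =
      -(z * condE P J (fun y => χ y * avoidProd A z S y) x) := by
    have : ∀ y, avoidProd A z (insert i S) y =
        avoidProd A z S y - z * (χ y * avoidProd A z S y) := fun y => by
      simp only [avoidProd, Finset.prod_insert hi]; ring
    rw [← condE_const_mul, hF]
    simp only [condE, this]
    rw [integral_sub (hbS.integrable_mix P J x)
      (((BddMeas.const z).mul (hbχ.mul hbS)).integrable_mix P J x)]
    ring
  have e2 : condE P J (fun y => χ y * avoidProd A z S y) x =
      condE P J (fun y => χ y * condE P (J ∪ W i) (avoidProd A z S) y) x := by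
    rw [← condE_condE P (hbχ.mul hbS) (Set.subset_union_left : J ⊆ J ∪ W i)]
    refine condE_congr P J x fun y => ?_
    exact condE_mul_left P (fun x y hxy => dependsOn_indicator (hW i)
      fun j hj => hxy j (Or.inr hj)) _ _
  have e3 : ‖condE P J (fun y => χ y * condE P (J ∪ W i) (avoidProd A z S) y) x‖ ≤
      κ * ‖F‖ * condProb P A J i x := by
    refine (norm_condE_le P _ _ _).trans ?_
    rw [condProb, ← condE_const_mul P (κ * ‖F‖)]
    refine condE_mono P (hbχ.mul (hbS.condE P _)).norm
      ((BddMeas.const _).mul (BddMeas.indicator_one (hA i))) J x fun y => ?_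
    have := hS J x (h.subset P A W (Finset.subset_insert _ _)) i hi y
    rw [norm_mul]
    by_cases hy : mix J x y ∈ A i
    · simpa [hχ, hy] using this
    · simp [hχ, hy]
  rw [e1, norm_neg, norm_mul, e2]
  calc ‖z‖ * _ ≤ ‖z‖ * (κ * ‖F‖ * condProb P A J i x) := by gcongr
    _ ≤ ‖z‖ * (κ * ‖F‖ * (1 / t)) := by gcongr
    _ = (‖z‖ * κ) / t * ‖F‖ := by ring
    _ ≤ a * ‖F‖ := by
      gcongr
      rwa [div_le_iff₀ ht0]

include hA hW in
theorem norm_condE_avoidProd_sdiff {z : ℂ} {t κ a : ℝ} (ht : 1 ≤ t) (hκ : 0 ≤ κ)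
    (ha : ‖z‖ * κ ≤ a * t) (ha0 : 0 ≤ a) (ha1 : a ≤ 1) {S : Finset I}
    (hS : ∀ S' ⊂ S, RevealBound P A W z t κ S')
    {J : Set ι} {x : ∀ j, Ω j} (h : Unlikely P A W t S J x) (N : Finset I) (hN : N ⊆ S) :
    (1 - a) ^ N.card * ‖condE P J (avoidProd A z (S \ N)) x‖ ≤ ‖condE P J (avoidProd A z S) x‖ ∧
    ‖condE P J (avoidProd A z S) x‖ ≤
      (1 + a) ^ N.card * ‖condE P J (avoidProd A z (S \ N)) x‖ := by
  induction N using Finset.induction_on with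
  | empty => simp
  | insert i N hi ih =>
    obtain ⟨ih1, ih2⟩ := ih ((Finset.subset_insert _ _).trans hN)
    have hiS : i ∈ S := hN (by simp)
    have e : S \ N = insert i (S \ insert i N) := by
      ext j
      by_cases hj : j = i
      · subst hj; simp [hiS, hi]
      · simp [hj]
    have hss : S \ insert i N ⊂ S := by
      refine ⟨Finset.sdiff_subset, fun hs => ?_⟩
      have := hs hiS
      simp at this
    have hun : Unlikely P A W t (insert i (S \ insert i N)) J x := by
      rw [← e]; exact h.subset P A W Finset.sdiff_subset
    have key := norm_condE_avoidProd_insert_sub_le P hA hW ht hκ ha (hS _ hss) (i := i)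
      (by simp) hun
    rw [← e] at key
    set G := condE P J (avoidProd A z (S \ insert i N)) x
    set G' := condE P J (avoidProd A z (S \ N)) x
    have u1 : ‖G'‖ ≤ (1 + a) * ‖G‖ := by
      have := norm_le_norm_add_norm_sub' G' G
      linarith
    have u2 : (1 - a) * ‖G‖ ≤ ‖G'‖ := by
      have := norm_le_norm_add_norm_sub' G G'
      rw [norm_sub_rev] at this
      linarith
    rw [Finset.card_insert_of_notMem hi, pow_succ, pow_succ]
    have p1 : 0 ≤ (1 - a) ^ N.card := pow_nonneg (by linarith) _
    have p2 : 0 ≤ (1 + a) ^ N.card := pow_nonneg (by linarith) _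
    constructor
    · rw [mul_assoc]
      exact (mul_le_mul_of_nonneg_left u2 p1).trans ih1
    · rw [mul_assoc]
      exact ih2.trans (mul_le_mul_of_nonneg_left u1 p2)

/-- The constants for which the induction on the number of events goes through. -/
structure RevealConstants (d : ℕ) (z : ℂ) (R η κ t a ρ : ℝ) : Prop where
  norm_le : ‖1 - z‖ ≤ R
  one_le_R : 1 ≤ R
  eta_nonneg : 0 ≤ η
  one_le_t : 1 ≤ t
  a_nonneg : 0 ≤ a
  a_lt_one : a < 1
  one_le_rho : 1 ≤ ρ
  norm_mul_le : ‖z‖ * κ ≤ a * t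
  ratio_le : (1 + a) ^ d ≤ ρ * (1 - a) ^ d
  kappa_ge : (R * (1 + η)) ^ d * ρ ≤ κ
  total_le : ρ + κ * (d * (1 / t)) ≤ 1 + η

theorem RevealConstants.rho_le {d : ℕ} {z : ℂ} {R η κ t a ρ : ℝ}
    (hc : RevealConstants d z R η κ t a ρ) : ρ ≤ κ := by
  refine le_trans ?_ hc.kappa_ge
  have : 1 ≤ R * (1 + η) := one_le_mul_of_one_le_of_one_le hc.one_le_R (by linarith [hc.eta_nonneg])
  have := one_le_pow₀ (n := d) this
  nlinarith [hc.one_le_rho]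

open Classical in
variable (W) in
/-- The events of `S` that share a coordinate off `J` with the event `u`. -/
noncomputable def touching (S : Finset I) (J : Set ι) (u : I) : Finset I :=
  S.filter fun k => ((W u ∩ W k) \ J).Nonempty

theorem mem_touching {S : Finset I} {J : Set ι} {u k : I} :
    k ∈ touching W S J u ↔ k ∈ S ∧ ((W u ∩ W k) \ J).Nonempty := by
  simp [touching]

theorem card_touching_le {d : ℕ} (hd : ∀ u, {j | j ≠ u ∧ (W j ∩ W u).Nonempty}.ncard ≤ d)
    {S : Finset I} {u : I} (hu : u ∉ S) (J : Set ι) : (touching W S J u).card ≤ d := by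
  refine le_trans ?_ (hd u)
  rw [← Set.ncard_coe_finset]
  refine Set.ncard_le_ncard (fun k hk => ?_) (Set.toFinite _)
  simp only [touching, Finset.coe_filter, Set.mem_ofPred_eq] at hk
  refine ⟨fun h => hu (h ▸ hk.1), ?_⟩
  rw [Set.inter_comm]
  exact hk.2.mono Set.sdiff_subset

include hW in
theorem condProb_union_mix {S : Finset I} {J : Set ι} {u k : I} (hk : k ∈ S)
    (h : k ∉ touching W S J u) (x y : ∀ j, Ω j) :
    condProb P A (J ∪ W u) k (mix J x y) = condProb P A J k x := by
  simp only [touching, Finset.mem_filter, hk, true_and, Set.not_nonempty_iff_eq_empty] at h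
  exact condE_union_mix P (dependsOn_indicator (hW k)) h x y

include hA hW in
-- Both sides are compared with the product over the events of `S` not touched by `u`, whose
-- conditional expectation does not notice the revealing. At most `d` events are removed on either
-- side, each at a cost of `1 ± a`.
theorem norm_condE_avoidProd_union_le {d : ℕ} {z : ℂ} {R η κ t a ρ : ℝ}
    (hc : RevealConstants d z R η κ t a ρ)
    (hd : ∀ u, {j | j ≠ u ∧ (W j ∩ W u).Nonempty}.ncard ≤ d) {S : Finset I}
    (hS : ∀ S' ⊂ S, RevealBound P A W z t κ S')
    {J : Set ι} {x : ∀ j, Ω j} (h : Unlikely P A W t S J x) {u : I} (hu : u ∉ S) (y : ∀ j, Ω j)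
    {B : Finset I} (hB : B ⊆ touching W S J u)
    (hun : Unlikely P A W t (S \ B) (J ∪ W u) (mix J x y)) :
    ‖condE P (J ∪ W u) (avoidProd A z (S \ B)) (mix J x y)‖ ≤
      ρ * ‖condE P J (avoidProd A z S) x‖ := by
  set N := touching W S J u with hN
  have hNS : N ⊆ S := fun k hk => (mem_touching.1 hk).1
  have hκ : 0 ≤ κ := by linarith [hc.rho_le, hc.one_le_rho]
  have ha0 := hc.a_nonneg
  have ha1 := hc.a_lt_one
  have hcard := card_touching_le hd hu J
  have r1 := (norm_condE_avoidProd_sdiff P hA hW hc.one_le_t hκ hc.norm_mul_le ha0 ha1.le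
    hS h N hNS).1
  have r2 := (norm_condE_avoidProd_sdiff P hA hW hc.one_le_t hκ hc.norm_mul_le ha0 ha1.le
    (fun S' hS' => hS S' (hS'.trans_subset Finset.sdiff_subset)) hun (N \ B)
    (Finset.sdiff_subset_sdiff hNS le_rfl)).2
  have e : (S \ B) \ (N \ B) = S \ N := by
    ext j
    have := @hB j
    simp only [Finset.mem_sdiff]
    tauto
  have e2 : condE P (J ∪ W u) (avoidProd A z (S \ N)) (mix J x y) =
      condE P J (avoidProd A z (S \ N)) x := by
    refine condE_union_mix P (dependsOn_avoidProd hW z (S \ N) (V := ⋃ k ∈ S \ N, W k)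
      fun k hk => Set.subset_biUnion_of_mem (u := W) hk) ?_ x y
    refine Set.eq_empty_of_forall_notMem fun l hl => ?_
    obtain ⟨⟨hlu, hlk⟩, hlJ⟩ := hl
    simp only [Set.mem_iUnion, Finset.mem_sdiff] at hlk
    obtain ⟨k, ⟨hkS, hkN⟩, hlk⟩ := hlk
    refine hkN ?_
    rw [hN, mem_touching]
    exact ⟨hkS, l, ⟨hlu, hlk⟩, hlJ⟩
  rw [e, e2] at r2
  set G := ‖condE P J (avoidProd A z (S \ N)) x‖
  have hG : 0 ≤ G := norm_nonneg _
  calc _ ≤ (1 + a) ^ (N \ B).card * G := r2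
    _ ≤ (1 + a) ^ d * G := by
      gcongr
      · linarith
      · exact (Finset.card_le_card Finset.sdiff_subset).trans hcard
    _ ≤ ρ * (1 - a) ^ d * G := by gcongr; exact hc.ratio_le
    _ ≤ ρ * ((1 - a) ^ N.card * G) := by
      rw [mul_assoc]
      have := hc.one_le_rho
      gcongr ρ * (?_ * G)
      exact pow_le_pow_of_le_one (by linarith) (by linarith) hcard
    _ ≤ _ := by
      have := hc.one_le_rho
      gcongr

include hA hW in
/-- Revealing the coordinates of `u`: whatever they turn out to be, the events that have become
likely can be dropped at a bounded cost. -/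
theorem condE_norm_condE_union_le {d : ℕ} {z : ℂ} {R η κ t a ρ : ℝ}
    (hc : RevealConstants d z R η κ t a ρ)
    (hd : ∀ u, {j | j ≠ u ∧ (W j ∩ W u).Nonempty}.ncard ≤ d) {S : Finset I}
    (hS : ∀ S' ⊂ S, RevealBound P A W z t κ S' ∧ MeanRevealBound P A W z t η S')
    {J : Set ι} {x : ∀ j, Ω j} (h : Unlikely P A W t S J x) {u : I} (hu : u ∉ S)
    {U : Finset I} (hU : Disjoint U S) (y : ∀ j, Ω j)
    (hin : Unlikely P A W t S (J ∪ W u) (mix J x y) →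
      condE P (J ∪ W u) (fun y => ‖condE P (J ∪ W u ∪ ⋃ v ∈ U, W v) (avoidProd A z S) y‖)
        (mix J x y) ≤ (1 + η) ^ U.card * ‖condE P (J ∪ W u) (avoidProd A z S) (mix J x y)‖) :
    condE P (J ∪ W u) (fun y => ‖condE P (J ∪ W u ∪ ⋃ v ∈ U, W v) (avoidProd A z S) y‖)
      (mix J x y) ≤ (1 + η) ^ U.card * ‖condE P J (avoidProd A z S) x‖ *
        (ρ + κ * ∑ k ∈ touching W S J u,
          t ^ revealRank W (J ∪ W u) k * condProb P A (J ∪ W u) k (mix J x y)) ∧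
    condE P (J ∪ W u) (fun y => ‖condE P (J ∪ W u ∪ ⋃ v ∈ U, W v) (avoidProd A z S) y‖)
      (mix J x y) ≤ (1 + η) ^ U.card * ‖condE P J (avoidProd A z S) x‖ * κ := by
  set J' := J ∪ W u with hJ'
  set x' := mix J x y with hx'
  set N := touching W S J u with hN
  set F := ‖condE P J (avoidProd A z S) x‖ with hF
  have hF0 : 0 ≤ F := norm_nonneg _
  have hη := hc.eta_nonneg
  have hρ := hc.one_le_rho
  have hρκ := hc.rho_le
  have hκ : 0 ≤ κ := by linarith
  have ht := hc.one_le_t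
  have hR := hc.one_le_R
  have hS1 : ∀ S' ⊂ S, RevealBound P A W z t κ S' := fun S' h => (hS S' h).1
  have hp : ∀ k, 0 ≤ t ^ revealRank W J' k * condProb P A J' k x' := fun k =>
    mul_nonneg (pow_nonneg (by linarith) _) (condProb_nonneg P J' k x')
  set Q := ∑ k ∈ N, t ^ revealRank W J' k * condProb P A J' k x' with hQ
  have hQ0 : 0 ≤ Q := Finset.sum_nonneg fun k _ => hp k
  have hpow : 0 ≤ (1 + η) ^ U.card * F := by positivity
  by_cases hgood : Unlikely P A W t S J' x'
  -- Good outcome: every event of `S` stays unlikely, and nothing has to be dropped.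
  · have h1 : ‖condE P J' (avoidProd A z S) x'‖ ≤ ρ * F := by
      have := norm_condE_avoidProd_union_le P hA hW hc hd hS1 h hu y (B := ∅) (by simp)
        (by simpa using hgood)
      simpa using this
    have h2 := hin hgood
    have h3 : (1 + η) ^ U.card * ‖condE P J' (avoidProd A z S) x'‖ ≤
        (1 + η) ^ U.card * F * ρ := by
      rw [mul_assoc, mul_comm F]; gcongr
    constructor
    · refine h2.trans (h3.trans ?_)
      have : 0 ≤ κ * Q := by positivity
      gcongr
      linarith
    · refine h2.trans (h3.trans ?_)
      gcongr
  · classical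
    -- Bad outcome: `B` collects the events that became likely. They are all touched by `u`, since
    -- an untouched event keeps its probability and no rank increases.
    set B := S.filter fun k => 1 ≤ t ^ revealRank W J' k * condProb P A J' k x' with hB
    have hBS : B ⊆ S := Finset.filter_subset _ _
    have hBN : B ⊆ N := by
      intro k hk
      rw [hB, Finset.mem_filter] at hk
      by_contra hkN
      have e := condProb_union_mix P hW hk.1 hkN x y
      have h1 := h k hk.1
      have h2 : t ^ revealRank W J' k ≤ t ^ revealRank W J k :=
        pow_le_pow_right₀ ht (revealRank_anti W Set.subset_union_left k)
      have h3 := mul_le_mul_of_nonneg_right h2 (condProb_nonneg P (A := A) J k x)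
      rw [← hJ', ← hx'] at e
      rw [e] at hk
      linarith [hk.2]
    have hBne : B.Nonempty := by
      simp only [Unlikely, not_forall, not_lt] at hgood
      obtain ⟨k, hk, hk1⟩ := hgood
      exact ⟨k, by rw [hB, Finset.mem_filter]; exact ⟨hk, hk1⟩⟩
    have hss : S \ B ⊂ S := by
      refine ⟨Finset.sdiff_subset, fun hs => ?_⟩
      obtain ⟨k, hk⟩ := hBne
      exact (Finset.mem_sdiff.1 (hs (hBS hk))).2 hk
    have hun : Unlikely P A W t (S \ B) J' x' := by
      intro k hk
      rw [hB, Finset.mem_sdiff, Finset.mem_filter, not_and, not_le] at hk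
      exact hk.2 hk.1
    have hBd : B.card ≤ d := (Finset.card_le_card hBN).trans (card_touching_le hd hu J)
    -- Markov's inequality in pointwise form: `Q` dominates the indicator of a bad outcome, so `κ`
    -- may be replaced by `ρ + κ * Q`.
    have hQ1 : 1 ≤ Q := by
      obtain ⟨k, hk⟩ := hBne
      refine (Finset.mem_filter.1 hk).2.trans ?_
      exact Finset.single_le_sum (f := fun k => t ^ revealRank W J' k * condProb P A J' k x')
        (fun k _ => hp k) (hBN hk)
    have b0 := norm_condE_avoidProd_union_le P hA hW hc hd hS1 h hu y hBN hun
    have hdis : Disjoint (U ∪ B) (S \ B) := by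
      rw [Finset.disjoint_union_left]
      exact ⟨hU.mono_right Finset.sdiff_subset, Finset.disjoint_sdiff⟩
    have b1 := (hS _ hss).2 J' x' hun (U ∪ B) hdis
    -- Revealing `B` as well can only raise the mean modulus. It makes the factors of `B` known, so
    -- they come out with modulus at most `R` each, and the induction hypothesis applies to `S \ B`
    -- with `U ∪ B` revealed.
    set V := J' ∪ ⋃ v ∈ U ∪ B, W v with hV
    have hbS := bddMeas_avoidProd hA z S
    have hbS' := bddMeas_avoidProd hA z (S \ B)
    have b2 : condE P J' (fun y => ‖condE P (J' ∪ ⋃ v ∈ U, W v) (avoidProd A z S) y‖) x' ≤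
        condE P J' (fun y => ‖condE P V (avoidProd A z S) y‖) x' := by
      refine condE_norm_condE_mono P hbS Set.subset_union_left
        (Set.union_subset_union_right _ ?_) x'
      exact Set.biUnion_subset_biUnion_left fun v hv => Finset.mem_union_left _ hv
    have b3 : condE P J' (fun y => ‖condE P V (avoidProd A z S) y‖) x' ≤
        R ^ B.card * condE P J' (fun y => ‖condE P V (avoidProd A z (S \ B)) y‖) x' := by
      rw [← condE_const_mul]
      refine condE_mono P (hbS.condE P V).norm
        ((BddMeas.const _).mul (hbS'.condE P V).norm) J' x' fun y => ?_
      have : condE P V (avoidProd A z S) (mix J' x' y) = avoidProd A z B (mix J' x' y) *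
          condE P V (avoidProd A z (S \ B)) (mix J' x' y) := by
        rw [← condE_mul_left P (dependsOn_avoidProd hW z B (V := V) fun k hk => ?_)]
        · exact condE_congr P _ _ fun w => avoidProd_sdiff z hBS _
        · exact (Set.subset_biUnion_of_mem (u := W) (s := (↑(U ∪ B) : Set I))
            (by simpa using Or.inr hk)).trans
            (Set.subset_union_right (s := J'))
      rw [this, norm_mul]
      gcongr
      exact norm_avoidProd_le hR hc.norm_le B _
    have b4 : condE P J' (fun y => ‖condE P (J' ∪ ⋃ v ∈ U, W v) (avoidProd A z S) y‖) x' ≤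
        (1 + η) ^ U.card * F * κ := by
      calc _ ≤ R ^ B.card * ((1 + η) ^ (U ∪ B).card *
            ‖condE P J' (avoidProd A z (S \ B)) x'‖) :=
            b2.trans (b3.trans (mul_le_mul_of_nonneg_left b1 (by positivity)))
        _ ≤ R ^ d * ((1 + η) ^ (U.card + d) * (ρ * F)) := by
            gcongr
            · linarith
            · exact (Finset.card_union_le _ _).trans (by omega)
        _ = (1 + η) ^ U.card * F * ((R * (1 + η)) ^ d * ρ) := by
            rw [pow_add, mul_pow]; ring
        _ ≤ _ := by gcongr; exact hc.kappa_ge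
    refine ⟨b4.trans ?_, b4⟩
    gcongr
    nlinarith

include hA hW in
-- The worst-case bound is the case `U = ∅` of the preceding estimate; the mean bound reveals the
-- events of `U` one by one and averages that estimate over the outcome of each.
theorem revealBound_and_meanRevealBound {d : ℕ} {z : ℂ} {R η κ t a ρ : ℝ}
    (hc : RevealConstants d z R η κ t a ρ)
    (hd : ∀ u, {j | j ≠ u ∧ (W j ∩ W u).Nonempty}.ncard ≤ d) (S : Finset I) :
    RevealBound P A W z t κ S ∧ MeanRevealBound P A W z t η S := by
  induction S using Finset.strongInduction with
  | H S hS =>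
  refine ⟨fun J x h u hu y => ?_, fun J x h U hU => ?_⟩
  · have := (condE_norm_condE_union_le P hA hW hc hd hS h hu (U := ∅) (by simp) y
      (fun _ => by simp [condE_norm_condE_self])).2
    simpa [condE_norm_condE_self, mul_comm] using this
  · induction U using Finset.induction_on generalizing J x with
    | empty => simp [condE_norm_condE_self]
    | insert u U hu ih =>
      rw [Finset.disjoint_insert_left] at hU
      set F := ‖condE P J (avoidProd A z S) x‖ with hF
      have hF0 : 0 ≤ F := norm_nonneg _
      have hη := hc.eta_nonneg
      have ht := hc.one_le_t
      have ht0 : 0 < t := by linarith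
      have hκ : 0 ≤ κ := by linarith [hc.rho_le, hc.one_le_rho]
      have hbS := bddMeas_avoidProd hA z S
      have e : J ∪ ⋃ v ∈ insert u U, W v = J ∪ W u ∪ ⋃ v ∈ U, W v := by
        rw [Finset.set_biUnion_insert, Set.union_assoc]
      have hbq : ∀ k, BddMeas (condProb P A (J ∪ W u) k) := fun k =>
        (BddMeas.indicator_one (hA k)).condE P _
      have hbQ : BddMeas fun x' => ρ + κ * ∑ k ∈ touching W S J u,
          t ^ revealRank W (J ∪ W u) k * condProb P A (J ∪ W u) k x' :=
        (BddMeas.const _).add ((BddMeas.const _).mul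
          (BddMeas.sum _ fun k _ => (BddMeas.const _).mul (hbq k)))
      rw [e, ← condE_condE P (hbS.condE P _).norm (Set.subset_union_left : J ⊆ J ∪ W u)]
      have s1 := condE_mono P ((hbS.condE P (J ∪ W u ∪ ⋃ v ∈ U, W v)).norm.condE P (J ∪ W u))
        ((BddMeas.const ((1 + η) ^ U.card * F)).mul hbQ) J x fun y =>
          (condE_norm_condE_union_le P hA hW hc hd hS h hU.1 hU.2 y
            (fun hg => ih _ _ hg hU.2)).1
      refine s1.trans ?_
      have s2 : condE P J (fun x' => ρ + κ * ∑ k ∈ touching W S J u,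
          t ^ revealRank W (J ∪ W u) k * condProb P A (J ∪ W u) k x') x =
          ρ + κ * ∑ k ∈ touching W S J u, t ^ revealRank W (J ∪ W u) k * condProb P A J k x := by
        unfold condE
        rw [integral_add (integrable_const _), integral_const_mul, integral_finsetSum]
        · simp only [integral_const_mul, integral_const, probReal_univ, one_smul]
          congr 2
          refine Finset.sum_congr rfl fun k _ => ?_
          congr 1
          exact condE_condE P (BddMeas.indicator_one (hA k)) Set.subset_union_left x
        · exact fun k _ => ((BddMeas.const _).mul (hbq k)).integrable_mix P J x
        · exact ((BddMeas.const _).mul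
            (BddMeas.sum _ fun k _ => (BddMeas.const _).mul (hbq k))).integrable_mix P J x
      rw [condE_const_mul, s2]
      -- The averaged probabilities are those before revealing `u`, but the ranks have dropped by at
      -- least one. Each summand is therefore less than `1 / t`.
      have s3 : ∑ k ∈ touching W S J u, t ^ revealRank W (J ∪ W u) k * condProb P A J k x ≤
          d * (1 / t) := by
        have hcard := card_touching_le hd hU.1 J
        calc _ ≤ ∑ k ∈ touching W S J u, 1 / t := by
              refine Finset.sum_le_sum fun k hk => ?_
              rw [mem_touching] at hk
              have hne : u ≠ k := fun h => hU.1 (h ▸ hk.1)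
              have h1 := h k hk.1
              have h2 : t ^ (revealRank W (J ∪ W u) k + 1) ≤ t ^ revealRank W J k :=
                pow_le_pow_right₀ ht (revealRank_union_lt W hne hk.2)
              have h3 := mul_le_mul_of_nonneg_right h2 (condProb_nonneg P (A := A) J k x)
              rw [le_div_iff₀ ht0]
              rw [pow_succ] at h3
              nlinarith
          _ ≤ d * (1 / t) := by
              rw [Finset.sum_const, nsmul_eq_mul]
              gcongr
      rw [Finset.card_insert_of_notMem hu, pow_succ]
      calc _ ≤ (1 + η) ^ U.card * F * (ρ + κ * (d * (1 / t))) := by gcongr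
        _ ≤ (1 + η) ^ U.card * F * (1 + η) :=
            mul_le_mul_of_nonneg_left hc.total_le (by positivity)
        _ = _ := by ring

include hA hW in
-- With nothing revealed, the events are removed one at a time down to the empty product `1`; each
-- removal costs a factor `1 - a`.
theorem pow_le_norm_integral_avoidProd {d : ℕ} {z : ℂ} {R η κ t a ρ : ℝ}
    (hc : RevealConstants d z R η κ t a ρ)
    (hd : ∀ u, {j | j ≠ u ∧ (W j ∩ W u).Nonempty}.ncard ≤ d) (S : Finset I)
    (h : ∀ k ∈ S, t ^ revealRank W ∅ k * (Measure.pi P).real (A k) < 1) :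
    (1 - a) ^ S.card ≤ ‖∫ x, avoidProd A z S x ∂(Measure.pi P)‖ := by
  have hne : Nonempty (∀ j, Ω j) := (Measure.pi P).nonempty_of_neZero
  obtain ⟨x⟩ := hne
  have hκ : 0 ≤ κ := by linarith [hc.rho_le, hc.one_le_rho]
  have hu : Unlikely P A W t S ∅ x := by
    intro k hk
    rw [condProb, condE_empty, integral_indicator_const _ (hA k)]
    simpa using h k hk
  have := (norm_condE_avoidProd_sdiff P hA hW hc.one_le_t hκ hc.norm_mul_le hc.a_nonneg
    hc.a_lt_one.le (fun S' _ => (revealBound_and_meanRevealBound P hA hW hc hd S').1) hu S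
    subset_rfl).1
  have e : condE P ∅ (avoidProd A z (S \ S)) x = 1 := by
    simp [condE_empty, avoidProd]
  rw [e, condE_empty] at this
  simpa using this

end ZeroFree

/-- The choice of constants for `d ≥ 5`. -/
theorem revealConstants_of_five_le {d : ℕ} (hd : 5 ≤ d) {z : ℂ} (hz : ‖1 - z‖ ≤ 1 + 1 / d) :
    RevealConstants d z (1 + 1 / d) (1 / d) 9 ((3 * d) ^ 3) (1 / d ^ 3) (1 + 7 / (10 * d)) := by
  have hd' : (5 : ℝ) ≤ d := by exact_mod_cast hd
  have hd0 : (0 : ℝ) < d := by linarith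
  have hd3 : (125 : ℝ) ≤ (d : ℝ) ^ 3 := by nlinarith [mul_le_mul hd' hd' (by norm_num) hd0.le]
  have hz2 : ‖z‖ ≤ 2 + 1 / d := by
    have := norm_sub_le (1 : ℂ) (1 - z)
    simp only [sub_sub_cancel, norm_one] at this
    linarith
  have hinv : (1 : ℝ) / d ≤ 1 / 5 := one_div_le_one_div_of_le (by norm_num) hd'
  have hinv3 : (1 : ℝ) / d ^ 3 ≤ 1 / 125 := one_div_le_one_div_of_le (by norm_num) hd3
  have hi0 : (0 : ℝ) < 1 / d := by positivity
  have hi3 : (0 : ℝ) < 1 / d ^ 3 := by positivity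
  have e3 : (1 : ℝ) / d ^ 3 = (1 / d) ^ 3 := by rw [div_pow, one_pow]
  have e7 : (7 : ℝ) / (10 * d) = 7 / 10 * (1 / d) := by field_simp
  refine ⟨hz, by linarith, hi0.le, ?_, hi3.le, by linarith, by rw [e7]; linarith, ?_, ?_, ?_, ?_⟩
  · nlinarith
  · have : 1 / (d : ℝ) ^ 3 * (3 * d) ^ 3 = 27 := by field_simp; norm_num
    rw [this]; linarith
  -- Use `(1 + a)(1 - 3a) ≤ 1 - a` and Bernoulli's inequality for `(1 - 3a) ^ d`. The constant `7 /
  -- 10` just suffices at `d = 5`.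
  · set a := (1 : ℝ) / d ^ 3 with ha
    have k1 : 1 + (d : ℝ) * (-(3 * a)) ≤ (1 + -(3 * a)) ^ d :=
      one_add_mul_le_pow (by linarith) d
    have k2 : (1 + a) ^ d * (1 + -(3 * a)) ^ d ≤ (1 - a) ^ d := by
      rw [← mul_pow]
      exact pow_le_pow_left₀ (mul_nonneg (by linarith) (by linarith)) (by nlinarith) d
    have hda : (d : ℝ) * a = (1 / d) ^ 2 := by rw [ha]; field_simp
    have k3 : 1 ≤ (1 + 7 / (10 * d)) * (1 + (d : ℝ) * (-(3 * a))) := by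
      have : (d : ℝ) * (-(3 * a)) = -(3 * (1 / d) ^ 2) := by rw [← hda]; ring
      rw [this, e7]
      set s := (1 : ℝ) / d
      nlinarith [mul_nonneg hi0.le hi0.le, mul_nonneg hi0.le (sub_nonneg.2 hinv),
        mul_nonneg (mul_nonneg hi0.le hi0.le) (sub_nonneg.2 hinv)]
    have hpos : 0 ≤ (1 + a) ^ d := by positivity
    have hρ : (0 : ℝ) ≤ 1 + 7 / (10 * d) := by positivity
    calc (1 + a) ^ d = (1 + a) ^ d * 1 := by ring
      _ ≤ (1 + a) ^ d * ((1 + 7 / (10 * d)) * (1 + (d : ℝ) * (-(3 * a)))) := by gcongr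
      _ ≤ (1 + a) ^ d * ((1 + 7 / (10 * d)) * (1 + -(3 * a)) ^ d) := by gcongr
      _ = (1 + 7 / (10 * d)) * ((1 + a) ^ d * (1 + -(3 * a)) ^ d) := by ring
      _ ≤ _ := by gcongr
  -- The value `κ = 9` comes from `(1 + 1/d) ^ (2d) ρ ≤ e² · 1.14 < 9`.
  · have h1 : (1 + 1 / (d : ℝ)) ^ d ≤ 2.7183 := by
      have : 1 + 1 / (d : ℝ) ≤ Real.exp (1 / d) := by
        linarith [Real.add_one_le_exp (1 / (d : ℝ))]
      calc (1 + 1 / (d : ℝ)) ^ d ≤ Real.exp (1 / d) ^ d := by gcongr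
        _ = Real.exp 1 := by rw [← Real.exp_nat_mul]; congr 1; field_simp
        _ ≤ 2.7183 := by linarith [Real.exp_one_lt_d9]
    have h0 : 0 ≤ (1 + 1 / (d : ℝ)) ^ d := by positivity
    rw [mul_pow, e7]
    have h2 : (1 + 1 / (d : ℝ)) ^ d * (1 + 1 / (d : ℝ)) ^ d ≤ 2.7183 * 2.7183 :=
      mul_le_mul h1 h1 h0 (by norm_num)
    calc _ ≤ 2.7183 * 2.7183 * (1 + 7 / 10 * (1 / 5 : ℝ)) := by gcongr
      _ ≤ 9 := by norm_num
  · have : (9 : ℝ) * (d * (1 / (3 * d) ^ 3)) = 1 / 3 * (1 / d) ^ 2 := by field_simp; norm_num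
    rw [this, e7]
    nlinarith

/-! ### Newton's identities -/

section PowerSums

/-- If `e k` are the coefficients of a power series with constant term `1`, then `logPow e k` is
`-k` times the coefficient of `X ^ k` in its logarithm. These are Newton's identities. -/
def logPow {S : Type*} [CommRing S] (e : ℕ → S) (k : ℕ) : S :=
  -(k : S) * e k - ∑ j : Fin k, logPow e j * e (k - j)
termination_by k
decreasing_by exact j.2

theorem map_logPow {S T : Type*} [CommRing S] [CommRing T] (φ : S →+* T) {e : ℕ → S} {e' : ℕ → T}
    (k : ℕ) (h : ∀ j ≤ k, φ (e j) = e' j) : φ (logPow e k) = logPow e' k := by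
  induction k using Nat.strong_induction_on with
  | _ k ih =>
  rw [logPow, logPow, map_sub, map_mul, map_neg, map_natCast, h k le_rfl, map_sum]
  congr 1
  refine Finset.sum_congr rfl fun j _ => ?_
  rw [map_mul, ih j j.2 fun i hi => h i (hi.trans j.2.le), h (k - j) (Nat.sub_le _ _)]

theorem totalDegree_logPow_le {σ S : Type*} [CommRing S] {e : ℕ → MvPolynomial σ S}
    (he : ∀ k, (e k).totalDegree ≤ 1) (k : ℕ) : (logPow e k).totalDegree ≤ k := by
  induction k using Nat.strong_induction_on with
  | _ k ih =>
  rw [logPow]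
  rcases Nat.eq_zero_or_pos k with rfl | hk
  · simp
  refine (MvPolynomial.totalDegree_sub _ _).trans (max_le ?_ ?_)
  · have : -(k : MvPolynomial σ S) * e k = MvPolynomial.C (-(k : S)) * e k := by simp
    rw [this]
    refine (MvPolynomial.totalDegree_mul _ _).trans ?_
    rw [MvPolynomial.totalDegree_C, zero_add]
    exact (he k).trans hk
  · refine MvPolynomial.totalDegree_finsetSum_le fun j _ => ?_
    have h1 := MvPolynomial.totalDegree_mul (logPow e j) (e (k - j))
    have h2 := ih j j.2
    have h3 := he (k - j)
    have h4 := j.2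
    omega

theorem eq_logPow {S : Type*} [CommRing S] {e p : ℕ → S} (h0 : e 0 = 1)
    (h : ∀ k, ∑ x ∈ Finset.HasAntidiagonal.antidiagonal k, p x.1 * e x.2 = -(k : S) * e k) (k : ℕ) :
    p k = logPow e k := by
  induction k using Nat.strong_induction_on with
  | _ k ih =>
  have := h k
  rw [Finset.Nat.sum_antidiagonal_eq_sum_range_succ (fun i j => p i * e j), Finset.sum_range_succ,
    Nat.sub_self, h0, mul_one, Finset.sum_range] at this
  have hs : ∑ j : Fin k, logPow e j * e (k - j) = ∑ j : Fin k, p j * e (k - j) :=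
    Finset.sum_congr rfl fun j _ => by rw [ih j j.2]
  rw [logPow, hs, ← this]
  ring

/-- The power series `∑_{k ≥ 1} a ^ k X ^ k`. -/
noncomputable def geomTail {S : Type*} [CommRing S] (a : S) : PowerSeries S :=
  PowerSeries.mk fun k => if k = 0 then 0 else a ^ k

theorem one_sub_mul_geomTail {S : Type*} [CommRing S] (a : S) :
    (1 - PowerSeries.C a * PowerSeries.X) * geomTail a = PowerSeries.C a * PowerSeries.X := by
  ext k
  rw [sub_mul, one_mul, mul_assoc, map_sub, PowerSeries.coeff_C_mul, PowerSeries.coeff_C_mul]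
  rcases k with _ | k
  · simp [geomTail]
  · rw [PowerSeries.coeff_succ_X_mul, PowerSeries.coeff_X]
    rcases k with _ | k
    · simp [geomTail]
    · simp [geomTail, pow_succ']

/-- The logarithmic derivative of a product, with denominators cleared. -/
theorem prod_one_sub_mul_sum_geomTail {S : Type*} [CommRing S] (s : Multiset S) :
    (s.map geomTail).sum * (s.map fun a => 1 - PowerSeries.C a * PowerSeries.X).prod =
      -(PowerSeries.X * PowerSeries.derivative S
        (s.map fun a => 1 - PowerSeries.C a * PowerSeries.X).prod) := by
  induction s using Multiset.induction_on with
  | empty => simp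
  | cons a s ih =>
    simp only [Multiset.map_cons, Multiset.sum_cons, Multiset.prod_cons, Derivation.leibniz,
      map_sub, smul_eq_mul, PowerSeries.derivative_C, PowerSeries.derivative_X,
      Derivation.map_one_eq_zero]
    have h := one_sub_mul_geomTail a
    linear_combination (1 - PowerSeries.C a * PowerSeries.X) * ih +
      (s.map fun a => 1 - PowerSeries.C a * PowerSeries.X).prod * h

theorem sum_pow_eq_logPow (s : Multiset ℂ) {k : ℕ} (hk : k ≠ 0) :
    (s.map fun a => a ^ k).sum =
      logPow (s.map fun a => 1 - Polynomial.C a * Polynomial.X).prod.coeff k := by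
  set N : Polynomial ℂ := (s.map fun a => 1 - Polynomial.C a * Polynomial.X).prod with hN
  have hNs : (N : PowerSeries ℂ) =
      (s.map fun a => 1 - PowerSeries.C a * PowerSeries.X).prod := by
    have := map_multiset_prod (Polynomial.coeToPowerSeries.ringHom (R := ℂ))
      (s.map fun a => 1 - Polynomial.C a * Polynomial.X)
    rw [Multiset.map_map] at this
    simpa [Function.comp_def] using this
  have hp := prod_one_sub_mul_sum_geomTail s
  rw [← hNs] at hp
  have hc : ∀ k, PowerSeries.coeff k (s.map geomTail).sum = logPow N.coeff k := by
    refine eq_logPow (p := fun k => PowerSeries.coeff k (s.map geomTail).sum) ?_ fun k => ?_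
    · rw [Polynomial.coeff_zero_eq_eval_zero, hN, Polynomial.eval_multiset_prod, Multiset.map_map]
      simp
    · have := congrArg (PowerSeries.coeff k) hp
      rw [PowerSeries.coeff_mul] at this
      simp only [Polynomial.coeff_coe] at this
      rw [this, map_neg]
      rcases k with _ | k
      · simp
      · rw [PowerSeries.coeff_succ_X_mul, PowerSeries.coeff_derivative, Polynomial.coeff_coe]
        push_cast
        ring
  rw [← hc k, map_multiset_sum, Multiset.map_map]
  refine congrArg Multiset.sum (Multiset.map_congr rfl fun a _ => ?_)
  rw [Function.comp_apply, geomTail, PowerSeries.coeff_mk, if_neg hk]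

end PowerSums

/-! ### Taylor approximation of the logarithm of a zero-free polynomial -/

section LogApprox

theorem abs_log_norm_one_sub_add_le {s : ℂ} (hs : ‖s‖ ≤ 1) {b : ℝ} (hb0 : 0 ≤ b) (hb1 : b < 1)
    (K : ℕ) :
    |Real.log ‖1 - s * b‖ + (∑ k ∈ Finset.range (K + 1), s ^ k * (b : ℂ) ^ k / k).re| ≤
      b ^ (K + 1) * (1 - b)⁻¹ := by
  have hz : ‖-(s * b)‖ ≤ b := by
    rw [norm_neg, norm_mul, Complex.norm_real, Real.norm_of_nonneg hb0]
    nlinarith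
  have h := Complex.norm_log_sub_logTaylor_le K (hz.trans_lt hb1)
  have hT : Complex.logTaylor (K + 1) (-(s * b)) =
      -∑ k ∈ Finset.range (K + 1), s ^ k * (b : ℂ) ^ k / k := by
    rw [Complex.logTaylor, ← Finset.sum_neg_distrib]
    refine Finset.sum_congr rfl fun k _ => ?_
    have : (-1 : ℂ) ^ (k + 1) * (-(s * b)) ^ k = -(s ^ k * b ^ k) := by
      rw [neg_pow (s * (b : ℂ)), pow_succ, mul_pow]
      have : (-1 : ℂ) ^ k * (-1) ^ k = 1 := by rw [← mul_pow]; simp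
      linear_combination (-(s ^ k * (b : ℂ) ^ k)) * this
    rw [this, neg_div]
  rw [hT, sub_neg_eq_add, ← sub_eq_add_neg] at h
  rw [← Complex.log_re, ← Complex.add_re]
  refine (Complex.abs_re_le_norm _).trans (h.trans ?_)
  have h1b : 0 < 1 - b := by linarith
  have hK : (1 : ℝ) ≤ K + 1 := by simp
  have h0 : 0 ≤ ‖-(s * b)‖ ^ (K + 1) * (1 - ‖-(s * b)‖)⁻¹ :=
    mul_nonneg (by positivity) (inv_nonneg.2 (by linarith))
  refine (div_le_self h0 hK).trans ?_
  have h2 : (1 - ‖-(s * (b : ℂ))‖)⁻¹ ≤ (1 - b)⁻¹ := inv_anti₀ h1b (by linarith)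
  exact mul_le_mul (pow_le_pow_left₀ (norm_nonneg _) hz _) h2
    (inv_nonneg.2 (by linarith)) (by positivity)

/-- Working with the logarithm of the modulus makes it additive over the factors, with no branch to
choose for the product. -/
theorem abs_log_norm_prod_add_le (s : Multiset ℂ) (hs : ∀ a ∈ s, ‖a‖ ≤ 1) {b : ℝ} (hb0 : 0 ≤ b)
    (hb1 : b < 1) (K : ℕ) :
    |Real.log ‖(s.map fun a => 1 - a * (b : ℂ)).prod‖ +
      (∑ k ∈ Finset.range (K + 1), (s.map fun a => a ^ k).sum * (b : ℂ) ^ k / k).re| ≤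
      s.card * (b ^ (K + 1) * (1 - b)⁻¹) := by
  induction s using Multiset.induction_on with
  | empty => simp
  | cons a s ih =>
    have hne : ∀ a : ℂ, ‖a‖ ≤ 1 → 1 - a * b ≠ 0 := by
      intro a ha h
      have : ‖a * b‖ = 1 := by rw [← sub_eq_zero.1 h, norm_one]
      rw [norm_mul, Complex.norm_real, Real.norm_of_nonneg hb0] at this
      nlinarith
    have hs' : ∀ c ∈ s, ‖c‖ ≤ 1 := fun c hc => hs c (Multiset.mem_cons_of_mem hc)
    have ha := hs a (Multiset.mem_cons_self a s)
    have hprod : (s.map fun a => 1 - a * (b : ℂ)).prod ≠ 0 := by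
      refine Multiset.prod_ne_zero fun h0 => ?_
      obtain ⟨c, hc, hc0⟩ := Multiset.mem_map.1 h0
      exact hne c (hs' c hc) hc0
    simp only [Multiset.map_cons, Multiset.prod_cons, Multiset.sum_cons, norm_mul,
      Multiset.card_cons]
    rw [Real.log_mul (norm_ne_zero_iff.2 (hne a ha)) (norm_ne_zero_iff.2 hprod)]
    simp only [add_mul, add_div, Finset.sum_add_distrib, Complex.add_re]
    have h1 := abs_log_norm_one_sub_add_le ha hb0 hb1 K
    have h2 := ih hs'
    push_cast
    rw [add_mul, one_mul, add_comm (s.card * _ : ℝ)]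
    refine le_trans (le_of_eq ?_) ((abs_add_le _ _).trans (add_le_add h1 h2))
    congr 1
    ring

theorem Polynomial.eq_prod_one_sub_of_eval_zero {N : Polynomial ℂ} (h0 : N.eval 0 = 1) :
    N = ((N.roots.map fun r => r⁻¹).map fun a => 1 - Polynomial.C a * Polynomial.X).prod := by
  have hN : N ≠ 0 := by rintro rfl; simp at h0
  have hsp : N = Polynomial.C N.leadingCoeff * (N.roots.map fun r => X - Polynomial.C r).prod :=
    (IsAlgClosed.splits N).eq_prod_roots
  have hr : ∀ r ∈ N.roots, r ≠ 0 := by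
    rintro r hr rfl
    rw [Polynomial.mem_roots hN, Polynomial.IsRoot, h0] at hr
    exact one_ne_zero hr
  have e : (N.roots.map fun r => X - Polynomial.C r).prod =
      Polynomial.C (N.roots.map fun r => -r).prod *
        ((N.roots.map fun r => r⁻¹).map fun a => 1 - Polynomial.C a * Polynomial.X).prod := by
    rw [map_multiset_prod, Multiset.map_map, Multiset.map_map, ← Multiset.prod_map_mul]
    refine congrArg _ (Multiset.map_congr rfl fun r h => ?_)
    have : Polynomial.C r * Polynomial.C r⁻¹ = 1 := by
      rw [← Polynomial.C_mul, mul_inv_cancel₀ (hr r h), Polynomial.C_1]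
    simp only [Function.comp_apply, Polynomial.C_neg]
    linear_combination (-Polynomial.X) * this
  rw [e, ← mul_assoc, ← Polynomial.C_mul] at hsp
  set c := N.leadingCoeff * (N.roots.map fun r => -r).prod
  set M := ((N.roots.map fun r => r⁻¹).map fun a => 1 - Polynomial.C a * Polynomial.X).prod with hM
  have hM0 : M.eval 0 = 1 := by
    rw [hM, Polynomial.eval_multiset_prod, Multiset.map_map]
    simp
  have hc : c = 1 := by
    have := congrArg (Polynomial.eval 0) hsp
    rw [h0, Polynomial.eval_mul, hM0, Polynomial.eval_C, mul_one] at this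
    exact this.symm
  rw [hsp, hc, Polynomial.C_1, one_mul]

/-- The logarithm of a polynomial without zeros in the closed unit disc is close to its Taylor
polynomial. -/
theorem abs_log_norm_eval_add_le {N : Polynomial ℂ} (h0 : N.eval 0 = 1)
    (hN : ∀ u : ℂ, ‖u‖ ≤ 1 → N.eval u ≠ 0) {b : ℝ} (hb0 : 0 ≤ b) (hb1 : b < 1) (K : ℕ) :
    |Real.log ‖N.eval (b : ℂ)‖ +
      (∑ k ∈ Finset.range (K + 1), logPow N.coeff k * (b : ℂ) ^ k / k).re| ≤
      N.natDegree * (b ^ (K + 1) * (1 - b)⁻¹) := by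
  have hN0 : N ≠ 0 := by rintro rfl; simp at h0
  set s := N.roots.map fun r => r⁻¹ with hs
  have hNs := Polynomial.eq_prod_one_sub_of_eval_zero h0
  rw [← hs] at hNs
  have hs1 : ∀ a ∈ s, ‖a‖ ≤ 1 := by
    intro a ha
    obtain ⟨r, hr, rfl⟩ := Multiset.mem_map.1 ha
    rw [Polynomial.mem_roots hN0] at hr
    have : 1 < ‖r‖ := by
      by_contra h
      exact hN r (not_lt.1 h) hr
    rw [norm_inv]
    exact inv_le_one_of_one_le₀ this.le
  have hcard : (s.card : ℝ) ≤ N.natDegree := by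
    rw [hs, Multiset.card_map]
    exact_mod_cast N.card_roots'
  have h := abs_log_norm_prod_add_le s hs1 hb0 hb1 K
  have e1 : N.eval (b : ℂ) = (s.map fun a => 1 - a * (b : ℂ)).prod := by
    conv_lhs => rw [hNs]
    rw [Polynomial.eval_multiset_prod, Multiset.map_map]
    simp
  have e2 : ∑ k ∈ Finset.range (K + 1), logPow N.coeff k * (b : ℂ) ^ k / k =
      ∑ k ∈ Finset.range (K + 1), (s.map fun a => a ^ k).sum * (b : ℂ) ^ k / k := by
    refine Finset.sum_congr rfl fun k _ => ?_
    -- At `k = 0` the power sum and `logPow` may differ, but both are divided by `0`, which gives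
    -- `0`.
    rcases eq_or_ne k 0 with rfl | hk
    · simp
    · rw [sum_pow_eq_logPow s hk, ← hNs]
  rw [e1, e2]
  refine h.trans ?_
  have : 0 ≤ b ^ (K + 1) * (1 - b)⁻¹ := mul_nonneg (by positivity) (inv_nonneg.2 (by linarith))
  gcongr

end LogApprox

/-! ### Pull-back along a Möbius map and the polynomial `Q` -/

section Interpolation

open Polynomial

/-- The `i`-th summand `(-c X) ^ i (1 - b X) ^ (n - i)` with `c = b⁻¹ - b` of the pull-back of a
polynomial of degree `n` along a Möbius map of discs. -/
noncomputable def discTerm (n : ℕ) (b : ℚ) (i : ℕ) : ℚ[X] :=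
  (C (-(b⁻¹ - b)) * X) ^ i * (1 - C b * X) ^ (n - i)

theorem discTerm_coeff_of_lt (n : ℕ) (b : ℚ) {i k : ℕ} (h : k < i) :
    (discTerm n b i).coeff k = 0 := by
  rw [discTerm, mul_pow, mul_assoc, ← C_pow, coeff_C_mul, coeff_X_pow_mul', if_neg (by omega),
    mul_zero]

theorem natDegree_discTerm_le (n : ℕ) (b : ℚ) {i : ℕ} (hi : i ≤ n) :
    (discTerm n b i).natDegree ≤ n := by
  have h1 : (C (-(b⁻¹ - b)) * X : ℚ[X]).natDegree ≤ 1 := (natDegree_C_mul_le _ _).trans natDegree_X_le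
  have h2 : (1 - C b * X : ℚ[X]).natDegree ≤ 1 :=
    (natDegree_sub_le _ _).trans (by simpa using (natDegree_C_mul_le b X).trans natDegree_X_le)
  refine natDegree_mul_le.trans ?_
  have h3 := natDegree_pow_le_of_le i h1
  have h4 := natDegree_pow_le_of_le (n - i) h2
  omega

/-- The `k`-th coefficient of the pull-back of `∑ s i (-z) ^ i`. -/
noncomputable def discCoeff {S : Type*} [CommRing S] [Algebra ℚ S] (n : ℕ) (b : ℚ) (s : ℕ → S)
    (k : ℕ) : S :=
  ∑ i ∈ Finset.range (n + 1), s i * algebraMap ℚ S ((discTerm n b i).coeff k)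

/-- The variables `σ_1, …, σ_K`, with `σ_0 = 1`, and `0` in place of the others. -/
noncomputable def sigmaVar (K i : ℕ) : MvPolynomial (Fin K) ℚ :=
  if i = 0 then 1 else if h : i - 1 < K then MvPolynomial.X ⟨i - 1, h⟩ else 0

/-- The Taylor polynomial of degree `K` of the logarithm, evaluated at `b`. -/
noncomputable def logTaylorPoly (n K : ℕ) (b : ℚ) : MvPolynomial (Fin K) ℚ :=
  ∑ k ∈ Finset.range (K + 1),
    MvPolynomial.C (b ^ k / k) * (MvPolynomial.C ((n : ℚ) * b ^ k) - logPow (discCoeff n b (sigmaVar K)) k)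

theorem totalDegree_sigmaVar_le (K i : ℕ) : (sigmaVar K i).totalDegree ≤ 1 := by
  unfold sigmaVar
  split_ifs <;> simp

theorem totalDegree_discCoeff_le (n K : ℕ) (b : ℚ) (k : ℕ) :
    (discCoeff n b (sigmaVar K) k).totalDegree ≤ 1 := by
  refine MvPolynomial.totalDegree_finsetSum_le fun i _ => ?_
  refine (MvPolynomial.totalDegree_mul _ _).trans ?_
  rw [MvPolynomial.algebraMap_eq, MvPolynomial.totalDegree_C]
  exact totalDegree_sigmaVar_le K i

theorem totalDegree_logTaylorPoly_le (n K : ℕ) (b : ℚ) :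
    (logTaylorPoly n K b).totalDegree ≤ K := by
  refine MvPolynomial.totalDegree_finsetSum_le fun k hk => ?_
  refine (MvPolynomial.totalDegree_mul _ _).trans ?_
  rw [MvPolynomial.totalDegree_C, zero_add]
  refine (MvPolynomial.totalDegree_sub _ _).trans (max_le
    ((MvPolynomial.totalDegree_C _).trans_le (Nat.zero_le _)) ?_)
  exact (totalDegree_logPow_le (totalDegree_discCoeff_le n K b) k).trans
    (Finset.mem_range_succ_iff.1 hk)

/-- The pull-back of `∑ s i (-z) ^ i` as a complex polynomial. -/
noncomputable def discPoly (n : ℕ) (b : ℚ) (s : ℕ → ℝ) : ℂ[X] :=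
  ∑ i ∈ Finset.range (n + 1), C (s i : ℂ) * (discTerm n b i).map (algebraMap ℚ ℂ)

theorem natDegree_discPoly_le (n : ℕ) (b : ℚ) (s : ℕ → ℝ) : (discPoly n b s).natDegree ≤ n := by
  refine natDegree_sum_le_of_forall_le _ _ fun i hi => ?_
  refine natDegree_C_mul_le _ _ |>.trans ?_
  exact natDegree_map_le.trans (natDegree_discTerm_le n b (Finset.mem_range_succ_iff.1 hi))

theorem coeff_discPoly (n : ℕ) (b : ℚ) (s : ℕ → ℝ) (k : ℕ) :
    (discPoly n b s).coeff k = discCoeff n b (fun i => (s i : ℂ)) k := by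
  simp [discPoly, discCoeff, finsetSum_coeff]

theorem eval_discPoly (n : ℕ) (b : ℚ) (s : ℕ → ℝ) {u : ℂ} (hu : 1 - b * u ≠ 0) :
    (discPoly n b s).eval u = (1 - b * u) ^ n *
      ∑ i ∈ Finset.range (n + 1), (s i : ℂ) * (-(((b : ℂ)⁻¹ - b) * u / (1 - b * u))) ^ i := by
  rw [discPoly, eval_finsetSum, Finset.mul_sum]
  refine Finset.sum_congr rfl fun i hi => ?_
  have hin : i ≤ n := Finset.mem_range_succ_iff.1 hi
  have e : (1 - (b : ℂ) * u) ^ n = (1 - b * u) ^ (n - i) * (1 - b * u) ^ i := by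
    rw [← pow_add, Nat.sub_add_cancel hin]
  rw [e, ← neg_div, div_pow]
  simp only [discTerm, eval_mul, eval_C, Polynomial.map_mul, Polynomial.map_pow, eval_pow,
    map_C, map_X, eval_X, Polynomial.map_sub, Polynomial.map_one, eval_sub, eval_one]
  simp only [eq_ratCast, Rat.cast_neg, Rat.cast_sub, Rat.cast_inv]
  field_simp

theorem map_logPow_discCoeff {n K : ℕ} (b : ℚ) {s : ℕ → ℝ} (hs : s 0 = 1) {k : ℕ} (hk : k ≤ K) :
    ((MvPolynomial.aeval (fun i : Fin K => s (i + 1)) (logPow (discCoeff n b (sigmaVar K)) k) : ℝ) : ℂ)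
      = logPow (discPoly n b s).coeff k := by
  refine map_logPow (Complex.ofRealHom.comp
    (MvPolynomial.aeval (fun i : Fin K => s (i + 1)) : MvPolynomial (Fin K) ℚ →ₐ[ℚ] ℝ).toRingHom)
    k fun j hj => ?_
  rw [coeff_discPoly, discCoeff, discCoeff, map_sum]
  refine Finset.sum_congr rfl fun i _ => ?_
  -- The `i`-th term is divisible by `X ^ i`, so the coefficient at `j ≤ K` involves no `s i` with
  -- `i > K`; setting those to `0` in `sigmaVar` is harmless.
  rcases lt_or_ge j i with hji | hji
  · simp [discTerm_coeff_of_lt n b hji]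
  · rw [map_mul]
    congr 1
    · rcases Nat.eq_zero_or_pos i with rfl | hi
      · simp [sigmaVar, hs]
      · have h : i - 1 < K := by omega
        simp [sigmaVar, hi.ne', h, Nat.sub_add_cancel hi]
    · simp

/-- The squares of the two sides differ by `(1 - b²)(1 - |u|²)`: a Blaschke factor maps the unit
disc into itself. -/
theorem norm_sub_le_norm_one_sub {b : ℝ} (hb0 : 0 ≤ b) (hb1 : b ≤ 1) {u : ℂ} (hu : ‖u‖ ≤ 1) :
    ‖(b : ℂ) - u‖ ≤ ‖1 - b * u‖ := by
  rw [← sq_le_sq₀ (norm_nonneg _) (norm_nonneg _), ← Complex.normSq_eq_norm_sq,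
    ← Complex.normSq_eq_norm_sq]
  have h : Complex.normSq u ≤ 1 := by
    rw [Complex.normSq_eq_norm_sq]; exact pow_le_one₀ (norm_nonneg _) hu
  simp only [Complex.normSq_apply, Complex.sub_re, Complex.sub_im, Complex.ofReal_re,
    Complex.ofReal_im, Complex.mul_re, Complex.mul_im, Complex.one_re, Complex.one_im] at h ⊢
  nlinarith [mul_nonneg (sub_nonneg.2 h) (sub_nonneg.2 (mul_le_one₀ hb1 hb0 hb1))]

/-- If `∑ s i (-z) ^ i` has no zeros in the disc of radius `1 / b` about `1`, then its logarithm at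
`1` is approximated by `logTaylorPoly`. -/
theorem abs_log_sub_aeval_logTaylorPoly_le (n K : ℕ) {b : ℚ} (hb0 : 0 < b) (hb1 : b < 1)
    {s : ℕ → ℝ} (hs : s 0 = 1)
    (hG : ∀ z : ℂ, ‖1 - z‖ ≤ (b : ℝ)⁻¹ → ∑ i ∈ Finset.range (n + 1), (s i : ℂ) * (-z) ^ i ≠ 0) :
    |Real.log (∑ i ∈ Finset.range (n + 1), s i * (-1) ^ i) -
      MvPolynomial.aeval (fun i : Fin K => s (i + 1)) (logTaylorPoly n K b)| ≤
      2 * n * ((b : ℝ) ^ (K + 1) * (1 - (b : ℝ))⁻¹) := by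
  have hbR0 : (0 : ℝ) < b := by exact_mod_cast hb0
  have hbR1 : (b : ℝ) < 1 := by exact_mod_cast hb1
  have hbC : (b : ℂ) ≠ 0 := by exact_mod_cast hb0.ne'
  have hcast : ((b : ℝ) : ℂ) = (b : ℂ) := by simp
  have hne : ∀ u : ℂ, ‖u‖ ≤ 1 → 1 - (b : ℂ) * u ≠ 0 := by
    intro u hu h
    have : ‖(b : ℂ) * u‖ = 1 := by rw [← sub_eq_zero.1 h, norm_one]
    rw [norm_mul, ← hcast, Complex.norm_real, Real.norm_of_nonneg hbR0.le] at this
    nlinarith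
  set N := discPoly n b s with hN
  have hN0 : N.eval 0 = 1 := by
    rw [hN, eval_discPoly n b s (by simp)]
    simp [Finset.sum_range_succ', hs]
  have hNne : ∀ u : ℂ, ‖u‖ ≤ 1 → N.eval u ≠ 0 := by
    intro u hu
    have h1 := hne u hu
    rw [hN, eval_discPoly n b s h1]
    refine mul_ne_zero (pow_ne_zero _ h1) (hG _ ?_)
    have : 1 - ((b : ℂ)⁻¹ - b) * u / (1 - b * u) = (b : ℂ)⁻¹ * ((b - u) / (1 - b * u)) := by
      field_simp
      ring
    rw [this, norm_mul, norm_inv, ← hcast, Complex.norm_real, Real.norm_of_nonneg hbR0.le, norm_div]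
    refine mul_le_of_le_one_right (by positivity) ?_
    refine div_le_one_of_le₀ ?_ (norm_nonneg _)
    exact norm_sub_le_norm_one_sub hbR0.le hbR1.le hu
  set g := ∑ i ∈ Finset.range (n + 1), s i * (-1) ^ i with hg
  have hgC : (g : ℂ) = ∑ i ∈ Finset.range (n + 1), (s i : ℂ) * (-1) ^ i := by
    rw [hg]; push_cast; rfl
  have hg0 : g ≠ 0 := by
    have := hG 1 (by simpa using hbR0.le)
    rw [← hgC] at this
    exact_mod_cast this
  have hbb : (0 : ℝ) < 1 - b * b := by nlinarith
  have hNb : N.eval ((b : ℝ) : ℂ) = ((1 - b * b : ℝ) : ℂ) ^ n * g := by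
    have hb' : 1 - (b : ℂ) * ((b : ℝ) : ℂ) ≠ 0 := by
      rw [hcast]; exact_mod_cast hbb.ne'
    rw [hN, eval_discPoly n b s hb', hgC, hcast]
    rw [hcast] at hb'
    have : ((b : ℂ)⁻¹ - b) * b / (1 - b * b) = 1 := by
      rw [sub_mul, inv_mul_cancel₀ hbC, div_self hb']
    rw [this]
    push_cast
    rfl
  -- Clearing denominators added `n * log (1 - b²)`; the terms `n * b ^ k` in `logTaylorPoly`
  -- approximate and remove it, which doubles the error.
  have hlogN : Real.log ‖N.eval ((b : ℝ) : ℂ)‖ = n * Real.log (1 - b * b) + Real.log g := by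
    rw [hNb, norm_mul, norm_pow, Complex.norm_real, Complex.norm_real,
      Real.log_mul (by simpa using fun h => absurd h hbb.ne') (by simpa using hg0), Real.log_pow,
      Real.norm_eq_abs, Real.norm_eq_abs, Real.log_abs, Real.log_abs]
  have h1 := abs_log_norm_eval_add_le hN0 hNne hbR0.le hbR1 K
  have h2 := abs_log_norm_one_sub_add_le (s := ((b : ℝ) : ℂ))
    (by rw [Complex.norm_real, Real.norm_of_nonneg hbR0.le]; exact hbR1.le) hbR0.le hbR1 K
  set T := (b : ℝ) ^ (K + 1) * (1 - (b : ℝ))⁻¹ with hT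
  have hT0 : 0 ≤ T := mul_nonneg (by positivity) (inv_nonneg.2 (by linarith))
  have h3 : |Real.log (1 - b * b) + ∑ k ∈ Finset.range (K + 1), (b : ℝ) ^ k * b ^ k / k| ≤ T := by
    have e1 : ‖(1 : ℂ) - ((b : ℝ) : ℂ) * ((b : ℝ) : ℂ)‖ = 1 - b * b := by
      rw [← Complex.ofReal_one, ← Complex.ofReal_mul, ← Complex.ofReal_sub, Complex.norm_real,
        Real.norm_of_nonneg hbb.le]
    have e2 : ∑ k ∈ Finset.range (K + 1), ((b : ℝ) : ℂ) ^ k * ((b : ℝ) : ℂ) ^ k / k =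
        ((∑ k ∈ Finset.range (K + 1), (b : ℝ) ^ k * b ^ k / k : ℝ) : ℂ) := by
      push_cast; rfl
    rwa [e1, e2, Complex.ofReal_re] at h2
  set L : ℕ → ℝ := fun k =>
    MvPolynomial.aeval (fun i : Fin K => s (i + 1)) (logPow (discCoeff n b (sigmaVar K)) k) with hL
  have h4 : |n * Real.log (1 - b * b) + Real.log g +
      ∑ k ∈ Finset.range (K + 1), L k * (b : ℝ) ^ k / k| ≤ n * T := by
    have e2 : ∑ k ∈ Finset.range (K + 1), logPow N.coeff k * ((b : ℝ) : ℂ) ^ k / k =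
        ((∑ k ∈ Finset.range (K + 1), L k * (b : ℝ) ^ k / k : ℝ) : ℂ) := by
      push_cast
      refine Finset.sum_congr rfl fun k hk => ?_
      rw [hL, hN, ← map_logPow_discCoeff b hs (Finset.mem_range_succ_iff.1 hk)]
    rw [e2, Complex.ofReal_re, hlogN] at h1
    refine h1.trans ?_
    gcongr
    exact natDegree_discPoly_le n b s
  have e5 : MvPolynomial.aeval (fun i : Fin K => s (i + 1)) (logTaylorPoly n K b) =
      n * ∑ k ∈ Finset.range (K + 1), (b : ℝ) ^ k * b ^ k / k -
        ∑ k ∈ Finset.range (K + 1), L k * (b : ℝ) ^ k / k := by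
    rw [logTaylorPoly, map_sum, Finset.mul_sum, ← Finset.sum_sub_distrib]
    refine Finset.sum_congr rfl fun k _ => ?_
    rw [map_mul, map_sub, MvPolynomial.aeval_C, MvPolynomial.aeval_C]
    simp only [eq_ratCast, Rat.cast_div, Rat.cast_pow, Rat.cast_natCast, Rat.cast_mul]
    rw [hL]
    ring
  rw [e5]
  have h5 : |n * (Real.log (1 - b * b) + ∑ k ∈ Finset.range (K + 1), (b : ℝ) ^ k * b ^ k / k)| ≤
      n * T := by
    rw [abs_mul, Nat.abs_cast]
    gcongr
  rw [abs_le] at *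
  constructor <;> linarith [h4.1, h4.2, h5.1, h5.2]

end Interpolation

/-! ### The generating function: inclusion-exclusion and its value at `1` -/

section Expansion

variable {ι : Type*} [Fintype ι] {Ω : ι → Type*} [∀ j, MeasurableSpace (Ω j)]
  (P : ∀ j, Measure (Ω j)) [∀ j, IsProbabilityMeasure (P j)]

theorem integral_avoidProd_eq_sum {n : ℕ} {A : Fin n → Set (∀ j, Ω j)}
    (hA : ∀ i, MeasurableSet (A i)) (z : ℂ) :
    ∫ x, avoidProd A z Finset.univ x ∂(Measure.pi P) =
      ∑ k ∈ Finset.range (n + 1), (intersectionSum (Measure.pi P) A k : ℂ) * (-z) ^ k := by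
  have h1 : ∀ x, avoidProd A z Finset.univ x = ∑ s : Finset (Fin n),
      (⋂ i ∈ s, A i).indicator (fun _ => (-z) ^ s.card) x := by
    intro x
    have : ∀ i, (1 : ℂ) - z * (A i).indicator (fun _ => (1 : ℂ)) x =
        (-z * (A i).indicator (fun _ => (1 : ℂ)) x) + 1 := fun i => by ring
    rw [avoidProd, Finset.prod_congr rfl fun i _ => this i, Finset.prod_add_one,
      Finset.powerset_univ]
    refine Finset.sum_congr rfl fun s _ => ?_
    rw [Finset.prod_mul_distrib, Finset.prod_const]
    by_cases hx : x ∈ ⋂ i ∈ s, A i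
    · rw [Set.indicator_of_mem hx]
      simp only [Set.mem_iInter] at hx
      rw [Finset.prod_congr rfl fun i hi => Set.indicator_of_mem (hx i hi) _]
      simp
    · rw [Set.indicator_of_notMem hx]
      simp only [Set.mem_iInter, not_forall] at hx
      obtain ⟨i, hi, hxi⟩ := hx
      rw [Finset.prod_eq_zero hi (Set.indicator_of_notMem hxi _), mul_zero]
  have hm : ∀ s : Finset (Fin n), MeasurableSet (⋂ i ∈ s, A i) := fun s =>
    Finset.measurableSet_biInter s fun i _ => hA i
  simp only [h1]
  rw [integral_finsetSum _ fun s _ => (integrable_const _).indicator (hm s)]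
  simp only [integral_indicator_const _ (hm _)]
  rw [← Finset.powerset_univ, Finset.sum_powerset, Finset.card_univ, Fintype.card_fin]
  refine Finset.sum_congr rfl fun k _ => ?_
  rw [intersectionSum, Complex.ofReal_sum, Finset.sum_mul]
  refine Finset.sum_congr rfl fun s hs => ?_
  rw [(Finset.mem_powersetCard.1 hs).2, Complex.real_smul]

theorem integral_avoidProd_one {I : Type*} [Fintype I] [DecidableEq I] {A : I → Set (∀ j, Ω j)}
    (hA : ∀ i, MeasurableSet (A i)) :
    ∫ x, avoidProd A 1 Finset.univ x ∂(Measure.pi P) =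
      ((Measure.pi P).real (⋂ i, (A i)ᶜ) : ℂ) := by
  have h1 : ∀ x, avoidProd A 1 Finset.univ x =
      (⋂ i, (A i)ᶜ).indicator (fun _ => (1 : ℂ)) x := by
    intro x
    by_cases hx : x ∈ ⋂ i, (A i)ᶜ
    · rw [Set.indicator_of_mem hx]
      simp only [Set.mem_iInter, Set.mem_compl_iff] at hx
      simp [avoidProd, hx]
    · rw [Set.indicator_of_notMem hx]
      simp only [Set.mem_iInter, Set.mem_compl_iff, not_forall, not_not] at hx
      obtain ⟨i, hi⟩ := hx
      exact Finset.prod_eq_zero (Finset.mem_univ i) (by simp [hi])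
  simp only [h1]
  rw [integral_indicator_const _ (MeasurableSet.iInter fun i => (hA i).compl), Complex.real_smul,
    mul_one]

end Expansion

/-! ### Zero-freeness under the hypotheses of the theorem -/

section LocalLemma

variable {m : ℕ} {Ω : Fin m → Type u} [∀ j, MeasurableSpace (Ω j)]
  (P : ∀ j, Measure (Ω j)) [∀ j, IsProbabilityMeasure (P j)]

theorem dependsOn_eventCoords (A : Set (∀ j, Ω j)) :
    DependsOn (fun x => x ∈ A) (eventCoords A) := by
  intro x y hxy
  have h : A.indicator (fun _ => (1 : ℂ)) x = A.indicator (fun _ => (1 : ℂ)) y :=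
    dependsOn_coordSet (A.indicator fun _ => (1 : ℂ)) hxy
  by_cases hx : x ∈ A <;> by_cases hy : y ∈ A <;> simp [hx, hy] at h ⊢

/-- The generating function of the events has no zeros in the disc of radius `1 + 1 / d` about
`1`. -/
theorem pow_le_norm_integral_avoidProd_univ {d n : ℕ} (hd : 5 ≤ d) {A : Fin n → Set (∀ j, Ω j)}
    {r D : Fin n → ℕ} (hA : ∀ i, MeasurableSet (A i))
    (hr : ∀ i, (eventCoords (A i)).ncard ≤ r i)
    (hD : ∀ i, {j : Fin n | j ≠ i ∧ ShareCoordinate (A j) (A i)}.ncard ≤ D i)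
    (hDd : ∀ i, D i ≤ d)
    (hp : ∀ i, (Measure.pi P).real (A i) <
      (3 * (d : ℝ)) ^ (-(3 * ((min (r i) (D i + 1) : ℕ) : ℤ))))
    {z : ℂ} (hz : ‖1 - z‖ ≤ 1 + 1 / d) :
    (1 - 1 / (d : ℝ) ^ 3) ^ n ≤ ‖∫ x, avoidProd A z Finset.univ x ∂(Measure.pi P)‖ := by
  have hc := revealConstants_of_five_le hd hz
  have := pow_le_norm_integral_avoidProd P (A := A) (W := fun i => eventCoords (A i)) hA
    (fun i => dependsOn_eventCoords (A i)) hc (fun i => (hD i).trans (hDd i)) Finset.univ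
    fun i _ => ?_
  · simpa using this
  · have hd0 : (0 : ℝ) < 3 * d := by
      have : (0 : ℝ) < d := by exact_mod_cast (by omega : 0 < d)
      linarith
    -- The initial rank is at most `μ_i`, so with `t = (3d)³` the hypothesis on the probabilities
    -- makes every event unlikely.
    have hrank : revealRank (fun i => eventCoords (A i)) ∅ i ≤ min (r i) (D i + 1) := by
      refine min_le_min ?_ ?_
      · simpa using hr i
      · simpa [ShareCoordinate] using hD i
    have h1 := hp i
    have e : (3 * (d : ℝ)) ^ (-(3 * ((min (r i) (D i + 1) : ℕ) : ℤ))) =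
        (((3 * (d : ℝ)) ^ 3) ^ min (r i) (D i + 1))⁻¹ := by
      rw [zpow_neg, zpow_mul, zpow_natCast]
      norm_cast
    rw [e] at h1
    have h2 : 0 < ((3 * (d : ℝ)) ^ 3) ^ min (r i) (D i + 1) := by positivity
    calc _ ≤ ((3 * (d : ℝ)) ^ 3) ^ min (r i) (D i + 1) * (Measure.pi P).real (A i) := by
          gcongr
          exact hc.one_le_t
      _ < ((3 * (d : ℝ)) ^ 3) ^ min (r i) (D i + 1) * (((3 * (d : ℝ)) ^ 3) ^ min (r i) (D i + 1))⁻¹ := by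
          gcongr
      _ = 1 := mul_inv_cancel₀ h2.ne'

end LocalLemma

/-! ### Truncation error and conclusion -/

theorem abs_exp_sub_le_of_abs_log_sub_le {p q ε : ℝ} (hp : 0 < p) (hε : ε < 1)
    (h : |Real.log p - q| ≤ ε / 2) : |Real.exp q - p| ≤ ε * p := by
  have h1 : Real.exp q = p * Real.exp (q - Real.log p) := by
    rw [Real.exp_sub, Real.exp_log hp]; field_simp
  have h2 : |q - Real.log p| ≤ ε / 2 := by rwa [abs_sub_comm]
  have h3 := Real.abs_exp_sub_one_le (x := q - Real.log p) (by linarith)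
  have e : Real.exp q - p = p * (Real.exp (q - Real.log p) - 1) := by rw [h1]; ring
  rw [e, abs_mul, abs_of_pos hp, mul_comm]
  gcongr
  linarith

/-- The number of terms of the Taylor expansion that gives an error of at most `ε / 2`. -/
theorem truncation_error_le {d n K : ℕ} (hd : 5 ≤ d) (hn : 1 ≤ n) {ε : ℝ} (hε : 0 < ε)
    (h2 : 2 ≤ (n : ℝ) / ε) (hK : Real.exp (20 * d) * Real.log (n / ε) < K + 1) :
    2 * n * (((d : ℝ) / (d + 1)) ^ (K + 1) * (1 - (d : ℝ) / (d + 1))⁻¹) ≤ ε / 2 := by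
  have hd' : (5 : ℝ) ≤ d := by exact_mod_cast hd
  have hn' : (1 : ℝ) ≤ n := by exact_mod_cast hn
  have hL : 1 / 2 ≤ Real.log (n / ε) := by
    have := Real.log_le_log (by norm_num) h2
    linarith [Real.log_two_gt_d9]
  set L := Real.log (n / ε) with hLdef
  have hM : 4 * ((d : ℝ) + 1) * (n / ε) = Real.exp (Real.log (4 * (d + 1)) + L) := by
    rw [Real.exp_add, Real.exp_log (by positivity), Real.exp_log (by positivity)]
  have h1 : (d + 1) * (Real.log (4 * (d + 1)) + L) ≤ K + 1 := by
    have hlog : Real.log (4 * (d + 1)) ≤ 4 * (d + 1) :=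
      (Real.log_le_sub_one_of_pos (by positivity)).trans (by linarith)
    have e1 : (d : ℝ) + 1 ≤ Real.exp (5 * d) := by linarith [Real.add_one_le_exp (5 * (d : ℝ))]
    have e2 : 8 * (d : ℝ) + 9 ≤ Real.exp (15 * d) := by
      linarith [Real.add_one_le_exp (15 * (d : ℝ))]
    -- Since `2 * L ≥ 1`, the term free of `L` is absorbed; only a quadratic factor in `d` is
    -- needed.
    calc (d + 1) * (Real.log (4 * (d + 1)) + L) ≤ (d + 1) * (4 * (d + 1) * (2 * L) + L) := by
          gcongr
          nlinarith
      _ = (d + 1) * (8 * d + 9) * L := by ring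
      _ ≤ Real.exp (5 * d) * Real.exp (15 * d) * L := by gcongr
      _ = Real.exp (20 * d) * L := by rw [← Real.exp_add]; ring_nf
      _ ≤ K + 1 := hK.le
  have hb : (d : ℝ) / (d + 1) ≤ Real.exp (-(1 / (d + 1))) := by
    have := Real.add_one_le_exp (-(1 / ((d : ℝ) + 1)))
    refine le_trans (le_of_eq ?_) this
    field_simp
    ring
  have hpow : ((d : ℝ) / (d + 1)) ^ (K + 1) ≤ (4 * ((d : ℝ) + 1) * (n / ε))⁻¹ := by
    calc ((d : ℝ) / (d + 1)) ^ (K + 1) ≤ Real.exp (-(1 / (d + 1))) ^ (K + 1) := by gcongr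
      _ = Real.exp (-((K + 1) / (d + 1))) := by
          rw [← Real.exp_nat_mul]; congr 1; push_cast; ring
      _ ≤ Real.exp (-(Real.log (4 * (d + 1)) + L)) := by
          refine Real.exp_le_exp.2 (neg_le_neg ?_)
          rw [le_div_iff₀ (by positivity)]
          linarith
      _ = _ := by rw [hM, Real.exp_neg]
  have e3 : (1 - (d : ℝ) / (d + 1))⁻¹ = d + 1 := by
    have : 1 - (d : ℝ) / (d + 1) = 1 / (d + 1) := by field_simp; ring
    rw [this, one_div, inv_inv]
  rw [e3]
  calc 2 * n * (((d : ℝ) / (d + 1)) ^ (K + 1) * (d + 1))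
      ≤ 2 * n * ((4 * ((d : ℝ) + 1) * (n / ε))⁻¹ * (d + 1)) := by gcongr
    _ = ε / 2 := by field_simp; ring

/-- The polynomial `Q` in `K` variables is evaluated at `(σ_1, …, σ_K)`; `C` is the absolute
constant in `K = e^{O(Δ)} ln (n / ε)`. -/
theorem theorem1p2 :
    ∃ C : ℝ, ∀ Δ n : ℕ, 5 ≤ Δ → 1 ≤ n → ∀ ε : ℝ, 0 < ε → ε < 1 →
      ∃ K : ℕ, (K : ℝ) ≤ Real.exp (C * (Δ : ℝ)) * Real.log ((n : ℝ) / ε) ∧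
      ∃ Q : MvPolynomial (Fin K) ℚ, Q.totalDegree ≤ K ∧
        ∀ (m : ℕ) (Ω : Fin m → Type u) [∀ j, MeasurableSpace (Ω j)]
          (P : ∀ j, Measure (Ω j)) [∀ j, IsProbabilityMeasure (P j)]
          (A : Fin n → Set (∀ j, Ω j)) (r D : Fin n → ℕ),
          (∀ i, MeasurableSet (A i)) →
          (∀ i, (eventCoords (A i)).ncard ≤ r i) →
          (∀ i, {j : Fin n | j ≠ i ∧ ShareCoordinate (A j) (A i)}.ncard ≤ D i) →
          Δ = max 5 (Finset.univ.sup D) →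
          (∀ i, (Measure.pi P).real (A i) <
            (3 * (Δ : ℝ)) ^ (-(3 * ((min (r i) (D i + 1) : ℕ) : ℤ)))) →
          0 < (Measure.pi P).real (⋂ i, (A i)ᶜ) ∧
          |Real.log ((Measure.pi P).real (⋂ i, (A i)ᶜ)) -
            MvPolynomial.aeval
              (fun k : Fin K => intersectionSum (Measure.pi P) A ((k : ℕ) + 1)) Q| ≤ ε ∧
          |Real.exp (MvPolynomial.aeval
              (fun k : Fin K => intersectionSum (Measure.pi P) A ((k : ℕ) + 1)) Q) -
            (Measure.pi P).real (⋂ i, (A i)ᶜ)| ≤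
              ε * (Measure.pi P).real (⋂ i, (A i)ᶜ) := by

  refine ⟨20, fun d n hd hn ε hε hε1 => ?_⟩
  have hd' : (5 : ℝ) ≤ d := by exact_mod_cast hd
  have hn' : (1 : ℝ) ≤ n := by exact_mod_cast hn
  have hnε : 1 ≤ (n : ℝ) / ε := by rw [le_div_iff₀ hε]; linarith
  have hlog : 0 ≤ Real.log ((n : ℝ) / ε) := Real.log_nonneg hnε
  -- When `n / ε` is near `1`, the bound on `K` forces `K = 0`. For `n / ε < 2` one has `n = 1` and
  -- `ε > 1/2`, and `Q = 0` works because `p ≥ 4/5`.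
  by_cases h2 : 2 ≤ (n : ℝ) / ε
  · set K := ⌊Real.exp (20 * d) * Real.log ((n : ℝ) / ε)⌋₊ with hK
    -- The reciprocal of `b` is the radius `1 + 1/d` of the zero-free disc; `b` is rational so that
    -- `Q` has rational coefficients.
    set b : ℚ := d / (d + 1) with hb
    have hbR : (b : ℝ) = d / (d + 1) := by rw [hb]; push_cast; rfl
    have hb0 : 0 < b := by
      have : (0 : ℚ) < d := by exact_mod_cast (by omega : 0 < d)
      positivity
    have hb1 : b < 1 := by rw [hb, div_lt_one (by positivity)]; linarith
    refine ⟨K, Nat.floor_le (by positivity), logTaylorPoly n K b,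
      totalDegree_logTaylorPoly_le n K b, ?_⟩
    intro m Ω _ P _ A r D hA hr hD hΔ hp
    have hDd : ∀ i, D i ≤ d := fun i => by
      rw [hΔ]; exact (Finset.le_sup (Finset.mem_univ i)).trans (le_max_right _ _)
    have hzf : ∀ z : ℂ, ‖1 - z‖ ≤ 1 + 1 / d → ∑ k ∈ Finset.range (n + 1),
        (intersectionSum (Measure.pi P) A k : ℂ) * (-z) ^ k ≠ 0 := by
      intro z hz h0
      have := pow_le_norm_integral_avoidProd_univ P hd hA hr hD hDd hp hz
      rw [integral_avoidProd_eq_sum P hA, h0, norm_zero] at this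
      have h1 : 1 / (d : ℝ) ^ 3 < 1 := by
        rw [div_lt_one (by positivity)]
        exact one_lt_pow₀ (by linarith) (by norm_num)
      exact absurd this (not_le.2 (pow_pos (by linarith) n))
    have hs0 : intersectionSum (Measure.pi P) A 0 = 1 := by
      simp [intersectionSum]
    have hp1 : (Measure.pi P).real (⋂ i, (A i)ᶜ) =
        ∑ k ∈ Finset.range (n + 1), intersectionSum (Measure.pi P) A k * (-1) ^ k := by
      have := integral_avoidProd_one P hA
      rw [integral_avoidProd_eq_sum P hA] at this
      exact_mod_cast this.symm
    have hpos : 0 < (Measure.pi P).real (⋂ i, (A i)ᶜ) := by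
      refine lt_of_le_of_ne measureReal_nonneg fun h => ?_
      refine hzf 1 (by simp; positivity) ?_
      rw [← integral_avoidProd_eq_sum P hA, integral_avoidProd_one P hA, ← h, Complex.ofReal_zero]
    have hbound := abs_log_sub_aeval_logTaylorPoly_le n K hb0 hb1 hs0 (fun z hz => hzf z (by
      refine hz.trans (le_of_eq ?_)
      rw [hbR]; field_simp))
    rw [← hp1, hbR] at hbound
    have hfin := hbound.trans (truncation_error_le hd hn hε h2 (Nat.lt_floor_add_one _))
    exact ⟨hpos, hfin.trans (by linarith), abs_exp_sub_le_of_abs_log_sub_le hpos hε1 hfin⟩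
  · have hn1 : n = 1 := by
      by_contra hne
      have : (2 : ℝ) ≤ n := by exact_mod_cast (by omega : 2 ≤ n)
      exact h2 (by rw [le_div_iff₀ hε]; nlinarith)
    have hε2 : 1 / 2 < ε := by
      rw [not_le, div_lt_iff₀ hε, hn1] at h2
      push_cast at h2
      linarith
    subst hn1
    refine ⟨0, by simpa using mul_nonneg (Real.exp_pos _).le hlog, 0, by simp, ?_⟩
    intro m Ω _ P _ A r D hA hr hD hΔ hp
    have hDd : ∀ i, D i ≤ d := fun i => by
      rw [hΔ]; exact (Finset.le_sup (Finset.mem_univ i)).trans (le_max_right _ _)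
    have hlow := pow_le_norm_integral_avoidProd_univ P hd hA hr hD hDd hp (z := 1)
      (by simp; positivity)
    rw [integral_avoidProd_one P hA, Complex.norm_real, Real.norm_of_nonneg measureReal_nonneg,
      pow_one] at hlow
    have hd3 : 1 / (d : ℝ) ^ 3 ≤ 1 / 5 := by
      refine one_div_le_one_div_of_le (by norm_num) ?_
      exact hd'.trans (le_self_pow₀ (by linarith) (by norm_num))
    have hpge : 4 / 5 ≤ (Measure.pi P).real (⋂ i, (A i)ᶜ) := by linarith
    have hple : (Measure.pi P).real (⋂ i, (A i)ᶜ) ≤ 1 := measureReal_le_one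
    set p := (Measure.pi P).real (⋂ i, (A i)ᶜ)
    have hpos : 0 < p := by linarith
    have hl : |Real.log p - 0| ≤ ε / 2 := by
      rw [sub_zero, abs_of_nonpos (Real.log_nonpos hpos.le hple)]
      have := Real.one_sub_inv_le_log_of_pos hpos
      have hinv : p⁻¹ ≤ 5 / 4 := by
        rw [inv_le_comm₀ hpos (by norm_num)]; linarith
      linarith
    rw [map_zero]
    exact ⟨hpos, hl.trans (by linarith), abs_exp_sub_le_of_abs_log_sub_le hpos hε1 hl⟩
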